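/- Let $\sigma\in[0,\infty)$ and $c<\infty$ be constants. For positive integers $m,n$ let $X=(x_1,\dots,x_n)^T$ be a random vector in $\mathbb{R}^n$ with i.i.d. real entries satisfying $$\mathbb{E}x_1=0,\qquad \mathbb{E}x_1^2=1,\qquad \mathbb{E}x_1^4=1+\sigma^2,$$ and let $S$ be a random $m\times n$ matrix with i.i.d. real entries satisfying $$\mathbb{E}S_{1,1}=0,\qquad \mathbb{E}S_{1,1}^2=1,\qquad \mathbb{E}S_{1,1}^4<c.$$ Assume that all the entries of $X$ and $S$ together are mutually independent. The laws of the entries may depend on $(m,n)$, but $\sigma$ and $c$ may not. Put $\xi=(\mathbb{E}S_{1,1}^4-1)\,\mathbb{E}x_1^4-2$ and, with $\|\cdot\|$ the Euclidean norm on $\mathbb{R}^m$, $$A(m,n)=\frac{\|SX\|^2-mn}{\sqrt{\sigma^2m^2n+2mn^2+\xi mn}}.$$ If $m,n\to\infty$ in such a way that $m/n\to0$, then $A(m,n)$ converges in distribution to the standard normal law $\mathcal{N}(0,1)$. -/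

import Mathlib

open MeasureTheory ProbabilityTheory Filter Topology

noncomputable section

/-- The constant `ξ = (E S₁₁⁴ - 1) E x₁⁴ - 2`, where `μ` is the law of the entries of the random
vector and `ν` is the law of the entries of the random matrix. -/
def projXi (μ ν : Measure ℝ) : ℝ :=
  ((∫ s, s ^ 4 ∂ν) - 1) * (∫ x, x ^ 4 ∂μ) - 2

/-- The centered and scaled squared Euclidean norm of the projected vector,
`(‖S X‖² - m n) / √(σ² m² n + 2 m n² + ξ m n)`. -/
def scaledProjNorm {m n : ℕ} (σ ξ : ℝ) (S : Matrix (Fin m) (Fin n) ℝ)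
    (X : EuclideanSpace ℝ (Fin n)) : ℝ :=
  (‖(WithLp.toLp 2 (S.mulVec X.ofLp) : EuclideanSpace ℝ (Fin m))‖ ^ 2 - (m : ℝ) * n) /
    Real.sqrt (σ ^ 2 * (m : ℝ) ^ 2 * n + 2 * (m : ℝ) * (n : ℝ) ^ 2 + ξ * m * n)

/-- `X` is a random vector with entries of law `μ`, `S` is a random matrix with entries of law `ν`,
and all the entries of `X` and `S` together are mutually independent. -/
structure IsIIDVectorMatrix {Ω : Type*} [MeasurableSpace Ω] (P : Measure Ω) {m n : ℕ}
    (X : Ω → EuclideanSpace ℝ (Fin n)) (S : Ω → Matrix (Fin m) (Fin n) ℝ)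
    (μ ν : Measure ℝ) : Prop where
  law_vector : ∀ j, HasLaw (fun ω => X ω j) μ P
  law_matrix : ∀ k j, HasLaw (fun ω => S ω k j) ν P
  indep : iIndepFun (fun (e : Fin n ⊕ (Fin m × Fin n)) (ω : Ω) =>
    Sum.elim (fun j => X ω j) (fun p => S ω p.1 p.2) e) P

end

/-! Expanding the square in each row splits `‖SX‖² - mn` into `T + R`. Here `R` sums the centred
diagonal terms `(x_j S_kj)² - 1`, and `T` sums over the rows `k` the off-diagonal quadratic forms
`q_k = ∑_{i≠j} x_i S_ki x_j S_kj`. When `m/n → 0` the normalisation is asymptotically `√(2m) n`. On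
that scale `E|R| = O(m√n)` contributes `O(√(m/n))`, so only `T` matters
(`integral_abs_sum_diag_le`). Given `X`, the `q_k` are i.i.d. and centred with variance `2 ∑_{i≠j}
x_i² x_j²`. Hence the characteristic function of `T` is the average over `x` of an `m`-th power
(`integral_cexp_sum_rows`), which a Lyapunov-type estimate compares with the Gaussian one. Its error
is controlled by two facts. First, `E|q_k|³ = O(n³)`: `q_k` is multilinear in the independent
products `x_j S_kj`, so fourth moments of the entries already give `E q_k⁴ = O(n⁴)`
(`integral_offDiag_four_le`). Second, the conditional variance divided by `2n²` tends to `1` in `L¹`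
(`integral_abs_offDiag_sq_sub_one_le`). The errors are `O(m^{-1/2})` and `O(n^{-1/2})`, and Lévy's
continuity theorem concludes. -/

noncomputable section

/-! ### Moments of sums and off-diagonal quadratic forms of independent variables -/

section Moments

variable {Ω ι : Type*} [MeasurableSpace Ω] {P : Measure Ω}

/-- Twice the second elementary symmetric function of `v i`, `i ∈ s`. -/
def offDiag (s : Finset ι) (v : ι → ℝ) : ℝ := (∑ i ∈ s, v i) ^ 2 - ∑ i ∈ s, v i ^ 2

lemma abs_pow_mul_pow_le {a b : ℕ} (hab : a + b ≤ 4) (x y : ℝ) :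
    |x ^ a * y ^ b| ≤ 1 + x ^ 4 + y ^ 4 := by
  set z := max 1 (max |x| |y|) with hz
  have h1 : 1 ≤ z := le_max_left _ _
  have hx : |x| ≤ z := (le_max_left _ _).trans (le_max_right _ _)
  have hy : |y| ≤ z := (le_max_right _ _).trans (le_max_right _ _)
  have h4 : z ^ 4 ≤ 1 + x ^ 4 + y ^ 4 := by
    have ex : |x| ^ 4 = x ^ 4 := by rw [← abs_pow, abs_of_nonneg (by positivity)]
    have ey : |y| ^ 4 = y ^ 4 := by rw [← abs_pow, abs_of_nonneg (by positivity)]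
    have px : 0 ≤ x ^ 4 := by positivity
    have py : 0 ≤ y ^ 4 := by positivity
    rcases max_choice 1 (max |x| |y|) with h | h
    · rw [hz, h]; linarith
    · rcases max_choice |x| |y| with h' | h'
      · rw [hz, h, h', ex]; linarith
      · rw [hz, h, h', ey]; linarith
  calc |x ^ a * y ^ b| = |x| ^ a * |y| ^ b := by rw [abs_mul, abs_pow, abs_pow]
    _ ≤ z ^ a * z ^ b := by gcongr
    _ = z ^ (a + b) := (pow_add _ _ _).symm
    _ ≤ z ^ 4 := pow_le_pow_right₀ h1 hab
    _ ≤ _ := h4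

lemma integrable_pow_mul_pow [IsFiniteMeasure P] {f g : Ω → ℝ} (hf : Measurable f)
    (hg : Measurable g) (hf4 : Integrable (fun ω => f ω ^ 4) P)
    (hg4 : Integrable (fun ω => g ω ^ 4) P) (a b : ℕ) (hab : a + b ≤ 4) :
    Integrable (fun ω => f ω ^ a * g ω ^ b) P := by
  refine Integrable.mono' (((integrable_const 1).add hf4).add hg4)
    ((hf.pow_const a).mul (hg.pow_const b)).aestronglyMeasurable (ae_of_all _ fun ω => ?_)
  exact abs_pow_mul_pow_le hab _ _

lemma integrable_pow_of_four [IsFiniteMeasure P] {f : Ω → ℝ} (hf : Measurable f)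
    (hf4 : Integrable (fun ω => f ω ^ 4) P) (a : ℕ) (ha : a ≤ 4) :
    Integrable (fun ω => f ω ^ a) P := by
  simpa using integrable_pow_mul_pow hf hf hf4 hf4 a 0 (by simpa using ha)

lemma integrable_of_four [IsFiniteMeasure P] {f : Ω → ℝ} (hf : Measurable f)
    (hf4 : Integrable (fun ω => f ω ^ 4) P) : Integrable f P := by
  simpa using integrable_pow_of_four hf hf4 1 (by norm_num)

lemma integrable_add_pow_four [IsFiniteMeasure P] {f g : Ω → ℝ} (hf : Measurable f)
    (hg : Measurable g) (hf4 : Integrable (fun ω => f ω ^ 4) P)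
    (hg4 : Integrable (fun ω => g ω ^ 4) P) : Integrable (fun ω => (f ω + g ω) ^ 4) P := by
  refine Integrable.mono' ((hf4.add hg4).const_mul 8)
    ((hf.add hg).pow_const 4).aestronglyMeasurable (ae_of_all _ fun ω => ?_)
  rw [Real.norm_eq_abs, abs_of_nonneg (by positivity)]
  change _ ≤ 8 * (f ω ^ 4 + g ω ^ 4)
  nlinarith [sq_nonneg (f ω ^ 2 - g ω ^ 2), sq_nonneg (f ω - g ω),
    mul_nonneg (sq_nonneg (f ω - g ω)) (sq_nonneg (f ω)),
    mul_nonneg (sq_nonneg (f ω - g ω)) (sq_nonneg (g ω)),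
    mul_nonneg (sq_nonneg (f ω - g ω)) (sq_nonneg (f ω + g ω))]

/-- The sum and the sum of squares are kept as a pair because `offDiag` and the linear sum are both
functions of it; every mixed moment in the inductions below then factors. -/
lemma iIndepFun.indepFun_sum_sumSq [DecidableEq ι] {w : ι → Ω → ℝ} (hw : ∀ i, Measurable (w i))
    (hi : iIndepFun w P) {a : ι} {s : Finset ι} (ha : a ∉ s) :
    IndepFun (w a) (fun ω => (∑ i ∈ s, w i ω, ∑ i ∈ s, w i ω ^ 2)) P := by
  have h := hi.indepFun_finset {a} s (by simpa using ha) hw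
  have hφ : Measurable fun v : ({a} : Finset ι) → ℝ => v ⟨a, by simp⟩ := measurable_pi_apply _
  have h2 := h.comp (φ := fun v : ({a} : Finset ι) → ℝ => v ⟨a, by simp⟩)
    (ψ := fun v : s → ℝ => (∑ i, v i, ∑ i, v i ^ 2)) hφ (by fun_prop)
  convert! h2 using 1
  funext ω
  simp only [Function.comp]
  rw [Finset.sum_coe_sort s (fun i => w i ω), Finset.sum_coe_sort s (fun i => w i ω ^ 2)]

lemma measurable_offDiag {w : ι → Ω → ℝ} (hw : ∀ i, Measurable (w i)) (s : Finset ι) :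
    Measurable (fun ω => offDiag s (fun i => w i ω)) := by
  unfold offDiag; fun_prop

lemma iIndepFun.indepFun_sum_offDiag [DecidableEq ι] {w : ι → Ω → ℝ} (hw : ∀ i, Measurable (w i))
    (hi : iIndepFun w P) {a : ι} {s : Finset ι} (ha : a ∉ s) (p b c : ℕ) :
    IndepFun (fun ω => w a ω ^ p)
      (fun ω => offDiag s (fun i => w i ω) ^ b * (∑ i ∈ s, w i ω) ^ c) P := by
  exact (iIndepFun.indepFun_sum_sumSq hw hi ha).comp (φ := fun x : ℝ => x ^ p)
    (ψ := fun z : ℝ × ℝ => (z.1 ^ 2 - z.2) ^ b * z.1 ^ c) (by fun_prop) (by fun_prop)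

/-- This recursion drives every moment computation: the new variable enters linearly, multiplied by
an independent sum. -/
lemma offDiag_insert [DecidableEq ι] {a : ι} {s : Finset ι} (ha : a ∉ s) (v : ι → ℝ) :
    offDiag (insert a s) v = offDiag s v + 2 * v a * ∑ i ∈ s, v i := by
  simp only [offDiag, Finset.sum_insert ha]; ring

lemma integral_sum_eq_zero {w : ι → Ω → ℝ} (hw : ∀ i, Integrable (w i) P) (h0 : ∀ i, ∫ ω, w i ω ∂P = 0)
    (s : Finset ι) : ∫ ω, ∑ i ∈ s, w i ω ∂P = 0 := by
  rw [integral_finsetSum _ fun i _ => hw i]; simp [h0]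

section

variable [IsProbabilityMeasure P] {w : ι → Ω → ℝ}

lemma integral_sum_sq_of_iIndepFun (hw : ∀ i, Measurable (w i)) (hi : iIndepFun w P)
    (h2 : ∀ i, Integrable (fun ω => w i ω ^ 2) P) (h0 : ∀ i, ∫ ω, w i ω ∂P = 0) (s : Finset ι) :
    Integrable (fun ω => (∑ i ∈ s, w i ω) ^ 2) P ∧
      ∫ ω, (∑ i ∈ s, w i ω) ^ 2 ∂P = ∑ i ∈ s, ∫ ω, w i ω ^ 2 ∂P := by
  classical
  have h2' : ∀ i, MemLp (w i) 2 P := fun i =>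
    (memLp_two_iff_integrable_sq (hw i).aestronglyMeasurable).2 (h2 i)
  have hs : MemLp (fun ω => ∑ i ∈ s, w i ω) 2 P := memLp_finsetSum s fun i _ => h2' i
  refine ⟨(memLp_two_iff_integrable_sq hs.1).1 hs, ?_⟩
  have hv := IndepFun.variance_sum (μ := P) (s := s) (X := w) (fun i _ => h2' i)
    fun i _ j _ hij => hi.indepFun hij
  rw [variance_of_integral_eq_zero, ] at hv
  · simp only [Finset.sum_apply] at hv
    rw [hv]
    refine Finset.sum_congr rfl fun i _ => ?_
    rw [variance_of_integral_eq_zero (hw i).aemeasurable (h0 i)]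
  · fun_prop
  · simp only [Finset.sum_apply]
    exact integral_sum_eq_zero (fun i => (h2' i).integrable (by norm_num)) h0 s

lemma integral_abs_sum_le_of_iIndepFun (hw : ∀ i, Measurable (w i)) (hi : iIndepFun w P)
    (h2 : ∀ i, Integrable (fun ω => w i ω ^ 2) P) (h0 : ∀ i, ∫ ω, w i ω ∂P = 0) {C : ℝ}
    (hC : ∀ i, ∫ ω, w i ω ^ 2 ∂P ≤ C) (s : Finset ι) :
    ∫ ω, |∑ i ∈ s, w i ω| ∂P ≤ Real.sqrt (s.card * C) := by
  obtain ⟨hint, heq⟩ := integral_sum_sq_of_iIndepFun hw hi h2 h0 s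
  have hm : MemLp (fun ω => |∑ i ∈ s, w i ω|) 2 P := by
    refine (memLp_two_iff_integrable_sq (by fun_prop)).2 ?_
    simpa [sq_abs] using hint
  have hv := variance_nonneg (fun ω => |∑ i ∈ s, w i ω|) P
  rw [variance_eq_sub hm] at hv
  apply Real.le_sqrt_of_sq_le
  have h3 : ∫ ω, ((fun ω => |∑ i ∈ s, w i ω|) ^ 2) ω ∂P = ∑ i ∈ s, ∫ ω, w i ω ^ 2 ∂P := by
    simp only [Pi.pow_apply, sq_abs]; exact heq
  rw [h3] at hv
  calc _ ≤ ∑ i ∈ s, ∫ ω, w i ω ^ 2 ∂P := by linarith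
    _ ≤ ∑ i ∈ s, C := Finset.sum_le_sum fun i _ => hC i
    _ = _ := by simp

lemma integrable_sum_four (hw : ∀ i, Measurable (w i))
    (h4 : ∀ i, Integrable (fun ω => w i ω ^ 4) P) (s : Finset ι) :
    Integrable (fun ω => (∑ i ∈ s, w i ω) ^ 4) P := by
  classical
  induction s using Finset.induction_on with
  | empty => simp
  | insert a s ha ih =>
    simp only [Finset.sum_insert ha]
    exact integrable_add_pow_four (hw a) (by fun_prop) (h4 a) ih

/-- The increment has degree eight, but its fourth power `16 w_a⁴ L⁴` is a product of independent
integrable factors, so fourth moments of the entries suffice. -/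
lemma integrable_offDiag_four (hw : ∀ i, Measurable (w i)) (hi : iIndepFun w P)
    (h4 : ∀ i, Integrable (fun ω => w i ω ^ 4) P) (s : Finset ι) :
    Integrable (fun ω => offDiag s (fun i => w i ω) ^ 4) P := by
  classical
  induction s using Finset.induction_on with
  | empty => simp [offDiag]
  | insert a s ha ih =>
    simp only [offDiag_insert ha]
    refine integrable_add_pow_four (measurable_offDiag hw s) (by fun_prop) ih ?_
    have h := ((iIndepFun.indepFun_sum_offDiag hw hi ha 4 0 4).integrable_mul (h4 a)
      (by simpa using integrable_sum_four hw h4 s)).const_mul 16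
    convert! h using 2 with ω
    simp only [Pi.mul_apply]; ring

lemma integral_mul_offDiag_pow [DecidableEq ι] (hw : ∀ i, Measurable (w i)) (hi : iIndepFun w P)
    (h4 : ∀ i, Integrable (fun ω => w i ω ^ 4) P) {a : ι} {s : Finset ι} (ha : a ∉ s)
    (p b c : ℕ) (hp : p ≤ 4) (hbc : b + c ≤ 4) :
    Integrable (fun ω => w a ω ^ p * (offDiag s (fun i => w i ω) ^ b * (∑ i ∈ s, w i ω) ^ c)) P ∧
    ∫ ω, w a ω ^ p * (offDiag s (fun i => w i ω) ^ b * (∑ i ∈ s, w i ω) ^ c) ∂P =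
      (∫ ω, w a ω ^ p ∂P) * ∫ ω, offDiag s (fun i => w i ω) ^ b * (∑ i ∈ s, w i ω) ^ c ∂P := by
  have hI := iIndepFun.indepFun_sum_offDiag hw hi ha p b c
  have h1 := integrable_pow_of_four (hw a) (h4 a) p hp
  have h2 := integrable_pow_mul_pow (measurable_offDiag hw s) (by fun_prop)
    (integrable_offDiag_four hw hi h4 s) (integrable_sum_four hw h4 s) b c hbc
  exact ⟨hI.integrable_mul h1 h2, hI.integral_fun_mul_eq_mul_integral h1.1 h2.1⟩

lemma integral_offDiag (hw : ∀ i, Measurable (w i)) (hi : iIndepFun w P)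
    (h4 : ∀ i, Integrable (fun ω => w i ω ^ 4) P) (h0 : ∀ i, ∫ ω, w i ω ∂P = 0) (s : Finset ι) :
    ∫ ω, offDiag s (fun i => w i ω) ∂P = 0 := by
  classical
  induction s using Finset.induction_on with
  | empty => simp [offDiag]
  | insert a s ha ih =>
    obtain ⟨hint, heq⟩ := integral_mul_offDiag_pow hw hi h4 ha 1 0 1 (by norm_num) (by norm_num)
    simp only [pow_one, pow_zero, one_mul, h0, zero_mul] at hint heq
    simp only [offDiag_insert ha, mul_assoc]
    rw [integral_add (integrable_of_four (measurable_offDiag hw s)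
      (integrable_offDiag_four hw hi h4 s)) (hint.const_mul 2), ih, integral_const_mul, heq]
    simp

/-- In the recursion the cross term vanishes since `w a` is centred, and `4 w_a² L²` contributes
exactly the increment of the right side. The variances may differ, as needed for the weighted
entries `x j * s j` with `x` frozen. -/
lemma integral_offDiag_sq (hw : ∀ i, Measurable (w i)) (hi : iIndepFun w P)
    (h4 : ∀ i, Integrable (fun ω => w i ω ^ 4) P) (h0 : ∀ i, ∫ ω, w i ω ∂P = 0) (s : Finset ι) :
    ∫ ω, offDiag s (fun i => w i ω) ^ 2 ∂P =
      2 * offDiag s (fun i => ∫ ω, w i ω ^ 2 ∂P) := by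
  classical
  induction s using Finset.induction_on with
  | empty => simp [offDiag]
  | insert a s ha ih =>
    obtain ⟨hint, heq⟩ := integral_mul_offDiag_pow hw hi h4 ha 1 1 1 (by norm_num) (by norm_num)
    obtain ⟨hint', heq'⟩ := integral_mul_offDiag_pow hw hi h4 ha 2 0 2 (by norm_num) (by norm_num)
    simp only [pow_one, pow_zero, one_mul, h0, zero_mul] at hint heq hint' heq'
    have hq := integrable_pow_of_four (measurable_offDiag hw s)
      (integrable_offDiag_four hw hi h4 s) 2 (by norm_num)
    have h2 := (integral_sum_sq_of_iIndepFun hw hi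
      (fun i => integrable_pow_of_four (hw i) (h4 i) 2 (by norm_num)) h0 s).2
    rw [h2] at heq'
    have e : ∀ ω, offDiag (insert a s) (fun i => w i ω) ^ 2 =
        offDiag s (fun i => w i ω) ^ 2 +
        4 * (w a ω * (offDiag s (fun i => w i ω) * ∑ i ∈ s, w i ω)) +
        4 * (w a ω ^ 2 * (∑ i ∈ s, w i ω) ^ 2) := fun ω => by
      rw [offDiag_insert ha]; ring
    simp only [e]
    rw [integral_add (hq.fun_add (hint.const_mul 4)) (hint'.const_mul 4),
      integral_add hq (hint.const_mul 4), integral_const_mul, integral_const_mul, ih, heq, heq',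
      offDiag_insert ha]
    ring

lemma integral_sum_four_le (hw : ∀ i, Measurable (w i)) (hi : iIndepFun w P)
    (h4 : ∀ i, Integrable (fun ω => w i ω ^ 4) P) (h0 : ∀ i, ∫ ω, w i ω ∂P = 0)
    (h2 : ∀ i, ∫ ω, w i ω ^ 2 ∂P = 1) {C : ℝ} (hC0 : 0 ≤ C) (hC : ∀ i, ∫ ω, w i ω ^ 4 ∂P ≤ C)
    (s : Finset ι) :
    ∫ ω, (∑ i ∈ s, w i ω) ^ 4 ∂P ≤ (3 + C) * (s.card : ℝ) ^ 2 := by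
  classical
  induction s using Finset.induction_on with
  | empty => simp
  | insert a s ha ih =>
    obtain ⟨i1, e1⟩ := integral_mul_offDiag_pow hw hi h4 ha 1 0 3 (by norm_num) (by norm_num)
    obtain ⟨i2, e2⟩ := integral_mul_offDiag_pow hw hi h4 ha 2 0 2 (by norm_num) (by norm_num)
    obtain ⟨i3, e3⟩ := integral_mul_offDiag_pow hw hi h4 ha 3 0 1 (by norm_num) (by norm_num)
    simp only [pow_one, pow_zero, one_mul, h0, h2, zero_mul] at i1 e1 i2 e2 i3 e3
    have h2' := (integral_sum_sq_of_iIndepFun hw hi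
      (fun i => integrable_pow_of_four (hw i) (h4 i) 2 (by norm_num)) h0 s).2
    rw [integral_sum_eq_zero (fun i => integrable_of_four (hw i) (h4 i)) h0 s, mul_zero] at e3
    rw [h2'] at e2
    simp only [h2, Finset.sum_const, nsmul_eq_mul, mul_one] at e2
    have e : ∀ ω, (∑ i ∈ insert a s, w i ω) ^ 4 =
        (∑ i ∈ s, w i ω) ^ 4 + 4 * (w a ω * (∑ i ∈ s, w i ω) ^ 3) +
        6 * (w a ω ^ 2 * (∑ i ∈ s, w i ω) ^ 2) + 4 * (w a ω ^ 3 * (∑ i ∈ s, w i ω)) +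
        w a ω ^ 4 := fun ω => by
      rw [Finset.sum_insert ha]; ring
    have j0 := integrable_sum_four hw h4 s
    have j1 := j0.fun_add (i1.const_mul 4)
    have j2 := j1.fun_add (i2.const_mul 6)
    have j3 := j2.fun_add (i3.const_mul 4)
    simp only [e]
    rw [integral_add j3 (h4 a), integral_add j2 (i3.const_mul 4), integral_add j1 (i2.const_mul 6),
      integral_add j0 (i1.const_mul 4), integral_const_mul, integral_const_mul, integral_const_mul,
      e1, e2, e3, Finset.card_insert_of_notMem ha]
    push_cast
    have hN : (0 : ℝ) ≤ s.card := Nat.cast_nonneg _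
    nlinarith [hC a, mul_nonneg hC0 hN]

/-- Adding a variable to `N` others must cost at most `4 K N³`, where `K = (100 + 16C)(3 + C)`. The
absorbed quartic term uses `2 K N³`; the terms in `L⁴` use `200(3 + C)N³ + 32 C(3 + C)N³`, which is
again exactly `2 K N³`. This fixes `K`. -/
lemma integral_offDiag_four_le (hw : ∀ i, Measurable (w i)) (hi : iIndepFun w P)
    (h4 : ∀ i, Integrable (fun ω => w i ω ^ 4) P) (h0 : ∀ i, ∫ ω, w i ω ∂P = 0)
    (h2 : ∀ i, ∫ ω, w i ω ^ 2 ∂P = 1) {C : ℝ} (hC0 : 0 ≤ C) (hC : ∀ i, ∫ ω, w i ω ^ 4 ∂P ≤ C)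
    (s : Finset ι) :
    ∫ ω, offDiag s (fun i => w i ω) ^ 4 ∂P ≤ (100 + 16 * C) * (3 + C) * (s.card : ℝ) ^ 4 := by
  classical
  induction s using Finset.induction_on with
  | empty => simp [offDiag]
  | insert a s ha ih =>
    obtain ⟨i1, e1⟩ := integral_mul_offDiag_pow hw hi h4 ha 1 3 1 (by norm_num) (by norm_num)
    obtain ⟨i2, e2⟩ := integral_mul_offDiag_pow hw hi h4 ha 2 2 2 (by norm_num) (by norm_num)
    obtain ⟨i3, e3⟩ := integral_mul_offDiag_pow hw hi h4 ha 4 0 4 (by norm_num) (by norm_num)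
    simp only [pow_one, pow_zero, one_mul, h0, h2, zero_mul] at i1 e1 i2 e2 i3 e3
    have jq := integrable_offDiag_four hw hi h4 s
    have jl := integrable_sum_four hw h4 s
    have j1 := jq.fun_add (i1.const_mul 8)
    have j2 := j1.fun_add (i2.const_mul 40)
    have j3 := j2.fun_add (i3.const_mul 32)
    -- The expansion of `(q + 2wL)⁴` contains `32 w³qL³`, whose sign is unknown; it is at most `16
    -- w²q²L² + 16 w⁴L⁴`, turning the coefficients 24 and 16 into 40 and 32.
    have step : ∫ ω, offDiag (insert a s) (fun i => w i ω) ^ 4 ∂P ≤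
        ∫ ω, offDiag s (fun i => w i ω) ^ 4 + 8 *
          (w a ω * (offDiag s (fun i => w i ω) ^ 3 * ∑ i ∈ s, w i ω)) +
        40 * (w a ω ^ 2 * (offDiag s (fun i => w i ω) ^ 2 * (∑ i ∈ s, w i ω) ^ 2)) +
        32 * (w a ω ^ 4 * (∑ i ∈ s, w i ω) ^ 4) ∂P := by
      refine integral_mono (integrable_offDiag_four hw hi h4 _) j3 fun ω => ?_
      simp only [offDiag_insert ha]
      generalize offDiag s (fun i => w i ω) = q
      generalize ∑ i ∈ s, w i ω = L
      nlinarith [sq_nonneg (w a ω * q * L - w a ω ^ 2 * L ^ 2)]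
    rw [integral_add j2 (i3.const_mul 32), integral_add j1 (i2.const_mul 40),
      integral_add jq (i1.const_mul 8), integral_const_mul, integral_const_mul, integral_const_mul,
      e1, e2, e3] at step
    have hl := integral_sum_four_le hw hi h4 h0 h2 hC0 hC s
    have hl0 : 0 ≤ ∫ ω, (∑ i ∈ s, w i ω) ^ 4 ∂P := integral_nonneg fun ω => by positivity
    rcases s.eq_empty_or_nonempty with rfl | hs
    · simp [offDiag]
      positivity
    have hN : (1 : ℝ) ≤ s.card := by exact_mod_cast hs.card_pos
    rw [Finset.card_insert_of_notMem ha]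
    push_cast
    set N : ℝ := (s.card : ℝ)
    have hN0 : 0 < N := by linarith
    -- The weight `2 / N` makes the `q⁴` part use half of the available increment `4 K N³`;
    -- completing the square then forces the factor `200 N` on `L⁴`.
    have amgm : 40 * ∫ ω, offDiag s (fun i => w i ω) ^ 2 * (∑ i ∈ s, w i ω) ^ 2 ∂P ≤
        2 / N * ∫ ω, offDiag s (fun i => w i ω) ^ 4 ∂P +
          200 * N * ∫ ω, (∑ i ∈ s, w i ω) ^ 4 ∂P := by
      rw [← integral_const_mul, ← integral_const_mul, ← integral_const_mul,
        ← integral_add (jq.const_mul _) (jl.const_mul _)]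
      refine integral_mono ((integrable_pow_mul_pow (measurable_offDiag hw s) (by fun_prop)
        jq jl 2 2 (by norm_num)).const_mul 40) ((jq.const_mul _).add (jl.const_mul _)) fun ω => ?_
      simp only
      generalize offDiag s (fun i => w i ω) = q
      generalize ∑ i ∈ s, w i ω = L
      have : 2 / N * q ^ 4 + 200 * N * L ^ 4 - 40 * (q ^ 2 * L ^ 2) =
        2 / N * (q ^ 2 - 10 * N * L ^ 2) ^ 2 := by field_simp; ring
      have h' : 0 ≤ 2 / N * (q ^ 2 - 10 * N * L ^ 2) ^ 2 := by positivity
      linarith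
    generalize ∫ ω, offDiag s (fun i => w i ω) ^ 4 ∂P = q at *
    generalize ∫ ω, (∑ i ∈ s, w i ω) ^ 4 ∂P = L at *
    have k1 : 2 / N * q ≤ 2 * ((100 + 16 * C) * (3 + C)) * N ^ 3 := by
      calc 2 / N * q ≤ 2 / N * ((100 + 16 * C) * (3 + C) * N ^ 4) := by gcongr
        _ = _ := by field_simp
    have k2 : 200 * N * L ≤ 200 * (3 + C) * N ^ 3 := by
      calc 200 * N * L ≤ 200 * N * ((3 + C) * N ^ 2) := by gcongr
        _ = _ := by ring
    have k3 : (∫ ω, w a ω ^ 4 ∂P) * L ≤ C * ((3 + C) * N ^ 3) := by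
      calc (∫ ω, w a ω ^ 4 ∂P) * L ≤ C * ((3 + C) * N ^ 2) :=
            mul_le_mul (hC a) hl hl0 hC0
        _ ≤ C * ((3 + C) * N ^ 3) := by
            gcongr
            norm_num
    have hK : 0 ≤ (100 + 16 * C) * (3 + C) := by positivity
    have k4 : (100 + 16 * C) * (3 + C) * (N + 1) ^ 4 ≥
        (100 + 16 * C) * (3 + C) * (N ^ 4 + 4 * N ^ 3) := by
      gcongr
      nlinarith [sq_nonneg N]
    nlinarith

end

end Moments

/-! ### Quantitative central limit estimate for characteristic functions -/

section CharFun

lemma norm_cexp_sub_taylor_two_le (y : ℝ) :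
    ‖Complex.exp (y * Complex.I) - (1 + y * Complex.I - (y : ℂ) ^ 2 / 2)‖ ≤ 4 * |y| ^ 3 := by
  have hn : ‖(y : ℂ) * Complex.I‖ = |y| := by simp
  rcases le_total |y| 1 with h | h
  · have h1 := Complex.norm_exp_sub_sum_le_norm_mul_exp ((y : ℂ) * Complex.I) 3
    have e : ∑ m ∈ Finset.range 3, ((y : ℂ) * Complex.I) ^ m / (m.factorial : ℂ) =
        1 + y * Complex.I - (y : ℂ) ^ 2 / 2 := by
      simp only [Finset.sum_range_succ, Finset.sum_range_zero, Nat.factorial, mul_pow,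
        Complex.I_sq]
      push_cast; ring
    rw [e, hn] at h1
    have h2 : Real.exp |y| ≤ 4 := by
      have := Real.exp_one_lt_d9
      have := Real.exp_le_exp.2 h
      linarith
    calc _ ≤ |y| ^ 3 * Real.exp |y| := h1
      _ ≤ |y| ^ 3 * 4 := by gcongr
      _ = _ := mul_comm _ _
  · calc _ ≤ ‖Complex.exp (y * Complex.I)‖ + ‖1 + y * Complex.I - (y : ℂ) ^ 2 / 2‖ :=
          norm_sub_le _ _
      _ ≤ 1 + (1 + |y| + |y| ^ 2 / 2) := by
          gcongr
          · exact (Complex.norm_exp_ofReal_mul_I y).le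
          · refine (norm_sub_le _ _).trans ?_
            gcongr
            · exact (norm_add_le _ _).trans (by simp)
            · simp
      _ ≤ 4 * |y| ^ 3 := by
          have a2 : |y| ≤ |y| ^ 3 := le_self_pow₀ h (by norm_num)
          have a3 : |y| ^ 2 ≤ |y| ^ 3 := pow_le_pow_right₀ h (by norm_num)
          linarith

/-- Telescoping: factors are exchanged one at a time, and the others have norm at most one. -/
lemma norm_pow_sub_pow_le_of_norm_le_one {a b : ℂ} (ha : ‖a‖ ≤ 1) (hb : ‖b‖ ≤ 1) (m : ℕ) :
    ‖a ^ m - b ^ m‖ ≤ m * ‖a - b‖ := by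
  induction m with
  | zero => simp
  | succ k ih =>
    have e : a ^ (k + 1) - b ^ (k + 1) = a ^ k * (a - b) + (a ^ k - b ^ k) * b := by ring
    rw [e]
    calc _ ≤ ‖a‖ ^ k * ‖a - b‖ + ‖a ^ k - b ^ k‖ * ‖b‖ := by
          refine (norm_add_le _ _).trans (by simp)
      _ ≤ 1 * ‖a - b‖ + (k * ‖a - b‖) * 1 := by
          gcongr
          exact pow_le_one₀ (norm_nonneg _) ha
      _ = _ := by push_cast; ring

lemma abs_exp_neg_sub_taylor_one_le {x : ℝ} (hx : 0 ≤ x) :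
    |Real.exp (-x) - (1 - x)| ≤ x ^ 2 := by
  have h1 := Real.add_one_le_exp (-x)
  rw [abs_of_nonneg (by linarith)]
  rcases le_total x 1 with h | h
  · have := Real.abs_exp_sub_one_sub_id_le (x := -x) (by rwa [abs_neg, abs_of_nonneg hx])
    have := (abs_le.1 this).2
    nlinarith
  · have : Real.exp (-x) ≤ 1 := Real.exp_le_one_iff.2 (by linarith)
    nlinarith

variable {Ω : Type*} [MeasurableSpace Ω] {P : Measure Ω} [IsProbabilityMeasure P]

lemma norm_integral_cexp_sub_taylor_le {g : Ω → ℝ} (hg : Measurable g)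
    (h4 : Integrable (fun ω => g ω ^ 4) P) (h0 : ∫ ω, g ω ∂P = 0) (u : ℝ) :
    ‖∫ ω, Complex.exp ((u * g ω : ℝ) * Complex.I) ∂P -
      ((1 - u ^ 2 / 2 * ∫ ω, g ω ^ 2 ∂P : ℝ) : ℂ)‖ ≤ 4 * |u| ^ 3 * ∫ ω, |g ω| ^ 3 ∂P := by
  have i1 : Integrable (fun ω => ((g ω : ℝ) : ℂ)) P := (integrable_of_four hg h4).ofReal
  have i2 : Integrable (fun ω => ((g ω ^ 2 : ℝ) : ℂ)) P :=
    (integrable_pow_of_four hg h4 2 (by norm_num)).ofReal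
  have i3 : Integrable (fun ω => |g ω| ^ 3) P := by
    simpa [abs_pow] using (integrable_pow_of_four hg h4 3 (by norm_num)).abs
  have iT : Integrable (fun ω => (1 + (u * g ω : ℝ) * Complex.I - ((u * g ω : ℝ) : ℂ) ^ 2 / 2)) P := by
    have := ((integrable_const (1 : ℂ)).fun_add (i1.const_mul (u * Complex.I))).sub
      (i2.const_mul ((u : ℂ) ^ 2 / 2))
    refine this.congr (ae_of_all _ fun ω => ?_)
    simp only [Pi.sub_apply]
    push_cast; ring
  have ie : Integrable (fun ω => Complex.exp ((u * g ω : ℝ) * Complex.I)) P := by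
    refine Integrable.of_bound (C := 1) (by fun_prop) (ae_of_all _ fun ω => ?_)
    exact (Complex.norm_exp_ofReal_mul_I _).le
  have eT : ∫ ω, (1 + (u * g ω : ℝ) * Complex.I - ((u * g ω : ℝ) : ℂ) ^ 2 / 2) ∂P =
      ((1 - u ^ 2 / 2 * ∫ ω, g ω ^ 2 ∂P : ℝ) : ℂ) := by
    have e : ∀ ω, (1 + (u * g ω : ℝ) * Complex.I - ((u * g ω : ℝ) : ℂ) ^ 2 / 2) =
        1 + u * Complex.I * ((g ω : ℝ) : ℂ) - (u : ℂ) ^ 2 / 2 * ((g ω ^ 2 : ℝ) : ℂ) := fun ω => by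
      push_cast; ring
    simp only [e]
    rw [integral_sub ((integrable_const (1 : ℂ)).fun_add (i1.const_mul (u * Complex.I)))
      (i2.const_mul ((u : ℂ) ^ 2 / 2)), integral_add (integrable_const (1 : ℂ))
      (i1.const_mul (u * Complex.I)), integral_const_mul, integral_const_mul,
      integral_complex_ofReal, integral_complex_ofReal, h0]
    simp
  rw [← eT, ← integral_sub ie iT]
  refine (norm_integral_le_of_norm_le (i3.const_mul (4 * |u| ^ 3)) (ae_of_all _ fun ω => ?_)).trans
    (integral_const_mul _ _).le
  refine (norm_cexp_sub_taylor_two_le _).trans (le_of_eq ?_)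
  rw [abs_mul, mul_pow]; ring

/-- If `g` is centered with second moment `V` then `E[exp(iug)]^m` is close to `exp(-τ/2)` as soon
as `m u² V` is close to `τ`. -/
lemma norm_integral_cexp_pow_sub_exp_le {g : Ω → ℝ} (hg : Measurable g)
    (h4 : Integrable (fun ω => g ω ^ 4) P) (h0 : ∫ ω, g ω ∂P = 0) (u : ℝ) {m : ℕ} (hm : 0 < m)
    {τ : ℝ} (hτ : 0 ≤ τ) :
    ‖(∫ ω, Complex.exp ((u * g ω : ℝ) * Complex.I) ∂P) ^ m - Complex.exp ((-τ / 2 : ℝ) : ℂ)‖ ≤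
      4 * m * |u| ^ 3 * ∫ ω, |g ω| ^ 3 ∂P + |m * u ^ 2 * (∫ ω, g ω ^ 2 ∂P) - τ| / 2 +
        τ ^ 2 / (4 * m) := by
  have hm' : (0 : ℝ) < m := by exact_mod_cast hm
  -- `b` is the `m`-th root of the Gaussian target, so the comparison of powers reduces to `m` times
  -- the distance of the bases.
  set b : ℝ := Real.exp (-(τ / (2 * m))) with hb
  have hbm : Complex.exp ((-τ / 2 : ℝ) : ℂ) = (b : ℂ) ^ m := by
    rw [← Complex.ofReal_exp, ← Complex.ofReal_pow, hb, ← Real.exp_nat_mul]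
    congr 2
    field_simp
  have ha1 : ‖∫ ω, Complex.exp ((u * g ω : ℝ) * Complex.I) ∂P‖ ≤ 1 := by
    refine (norm_integral_le_of_norm_le_const (C := 1) (ae_of_all _ fun ω => ?_)).trans (by simp)
    exact (Complex.norm_exp_ofReal_mul_I _).le
  have hb1 : ‖(b : ℂ)‖ ≤ 1 := by
    rw [Complex.norm_real, Real.norm_eq_abs, abs_of_pos (Real.exp_pos _), Real.exp_le_one_iff]
    have : 0 ≤ τ / (2 * m) := by positivity
    linarith
  rw [hbm]
  refine (norm_pow_sub_pow_le_of_norm_le_one ha1 hb1 m).trans ?_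
  set V := ∫ ω, g ω ^ 2 ∂P
  have h1 := norm_integral_cexp_sub_taylor_le hg h4 h0 u
  have h2 : |(1 - u ^ 2 / 2 * V) - (1 - τ / (2 * m))| = |m * u ^ 2 * V - τ| / (2 * m) := by
    rw [← abs_of_pos (show 0 < 2 * (m : ℝ) by positivity), ← abs_div,
      abs_of_pos (show 0 < 2 * (m : ℝ) by positivity), ← abs_neg]
    congr 1; field_simp; ring
  have h3 := abs_exp_neg_sub_taylor_one_le (x := τ / (2 * m)) (by positivity)
  have h4 : ‖((1 - u ^ 2 / 2 * V : ℝ) : ℂ) - (b : ℂ)‖ ≤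
      |m * u ^ 2 * V - τ| / (2 * m) + (τ / (2 * m)) ^ 2 := by
    rw [← Complex.ofReal_sub, Complex.norm_real, Real.norm_eq_abs, ← h2]
    refine (abs_sub_le _ (1 - τ / (2 * m)) _).trans ?_
    rw [abs_sub_comm _ b]
    gcongr
  calc _ ≤ m * (4 * |u| ^ 3 * ∫ ω, |g ω| ^ 3 ∂P +
        (|m * u ^ 2 * V - τ| / (2 * m) + (τ / (2 * m)) ^ 2)) := by
        gcongr
        exact (norm_sub_le_norm_sub_add_norm_sub _ _ _).trans (add_le_add h1 h4)
    _ = _ := by field_simp; ring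

end CharFun

/-! ### Standardized laws, entrywise products and concentration -/

section Product

/-- A centered law on `ℝ` with unit variance and fourth moment at most `C`. -/
structure IsStandardizedLaw (μ : Measure ℝ) (C : ℝ) : Prop where
  integrable_four : Integrable (fun x : ℝ => x ^ 4) μ
  mean : ∫ x, x ∂μ = 0
  var : ∫ x, x ^ 2 ∂μ = 1
  four_le : ∫ x, x ^ 4 ∂μ ≤ C

lemma ProbabilityTheory.HasLaw.integrable_fun_comp {Ω 𝓧 : Type*} [MeasurableSpace Ω]
    [MeasurableSpace 𝓧] {P : Measure Ω} {ρ : Measure 𝓧} {X : Ω → 𝓧} (hX : HasLaw X ρ P) {f : 𝓧 → ℝ}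
    (hf : Integrable f ρ) : Integrable (fun ω => f (X ω)) P := by
  rw [← hX.map_eq] at hf
  exact hf.comp_aemeasurable hX.aemeasurable

/-- Lets independence be checked on a convenient model: for the products `x j * s j`, on the space
of families of pairs, where it is coordinatewise. -/
lemma iIndepFun_of_comp_measurePreserving {Ω Ω' ι : Type*} [Fintype ι] [MeasurableSpace Ω]
    [MeasurableSpace Ω'] {P : Measure Ω} {P' : Measure Ω'} [IsProbabilityMeasure P]
    [IsProbabilityMeasure P'] {f : Ω → Ω'} (hf : MeasurePreserving f P P') {w : ι → Ω' → ℝ}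
    (hw : ∀ i, Measurable (w i)) (h : iIndepFun (fun i ω => w i (f ω)) P) : iIndepFun w P' := by
  have hfm := hf.measurable
  rw [iIndepFun_iff_map_fun_eq_pi_map fun i => (hw i).aemeasurable, ← hf.map_eq,
    Measure.map_map (by fun_prop) hfm]
  have := h.map_fun_eq_pi_map fun i => ((hw i).comp hfm).aemeasurable
  simp only [Measure.map_map (hw _) hfm]
  exact this

variable {μ ν : Measure ℝ} [IsProbabilityMeasure μ] [IsProbabilityMeasure ν] {A B : ℝ} {m n : ℕ}

lemma integral_pow_two_le {C : ℝ} (h : IsStandardizedLaw μ C) :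
    Integrable (fun x : ℝ => (x ^ 2 - 1) ^ 2) μ ∧ ∫ x, (x ^ 2 - 1) ^ 2 ∂μ ≤ C - 1 := by
  have i2 : Integrable (fun x : ℝ => x ^ 2) μ :=
    integrable_pow_of_four measurable_id h.integrable_four 2 (by norm_num)
  have e : ∀ x : ℝ, (x ^ 2 - 1) ^ 2 = x ^ 4 - 2 * x ^ 2 + 1 := fun x => by ring
  simp only [e]
  have j : Integrable (fun x : ℝ => x ^ 4 - 2 * x ^ 2) μ := h.integrable_four.sub (i2.const_mul 2)
  refine ⟨j.fun_add (integrable_const 1), ?_⟩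
  rw [integral_add j (integrable_const 1), integral_sub h.integrable_four (i2.const_mul 2),
    integral_const_mul, h.var]
  have := h.four_le
  simp only [integral_const, probReal_univ, smul_eq_mul]
  linarith

lemma IsStandardizedLaw.one_le {C : ℝ} (h : IsStandardizedLaw μ C) : 1 ≤ C := by
  have h1 := (integral_pow_two_le h).2
  have h2 : 0 ≤ ∫ x, (x ^ 2 - 1) ^ 2 ∂μ := integral_nonneg fun x => by positivity
  linarith

/-- The law of a product of independent standardized variables is standardized. -/
lemma IsStandardizedLaw.mul (hμ : IsStandardizedLaw μ A) (hν : IsStandardizedLaw ν B) :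
    IsStandardizedLaw ((μ.prod ν).map fun z => z.1 * z.2) (A * B) := by
  have key : ∀ k : ℕ, ∫ x, x ^ k ∂((μ.prod ν).map fun z => z.1 * z.2) =
      (∫ x, x ^ k ∂μ) * ∫ x, x ^ k ∂ν := fun k => by
    rw [integral_map (by fun_prop) (by fun_prop)]
    simp only [mul_pow]
    exact integral_prod_mul (fun x : ℝ => x ^ k) (fun x : ℝ => x ^ k)
  refine ⟨?_, ?_, ?_, ?_⟩
  · rw [integrable_map_measure (by fun_prop) (by fun_prop)]
    simp only [Function.comp_def, mul_pow]
    exact hμ.integrable_four.mul_prod hν.integrable_four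
  · have := key 1
    simp only [pow_one] at this
    rw [this, hμ.mean, zero_mul]
  · rw [key, hμ.var, hν.var, one_mul]
  · rw [key]
    have h0 : 0 ≤ ∫ x, x ^ 4 ∂ν := integral_nonneg fun x => by positivity
    have := hμ.one_le
    exact mul_le_mul hμ.four_le hν.four_le h0 (by linarith)

section Standardized

variable {Ω ι : Type*} [MeasurableSpace Ω] {P : Measure Ω} [IsProbabilityMeasure P] {C : ℝ}

lemma integral_abs_sum_sq_sub_one_le {w : ι → Ω → ℝ} (hw : ∀ i, Measurable (w i))
    (hi : iIndepFun w P) {ρ : ι → Measure ℝ} [∀ i, IsProbabilityMeasure (ρ i)]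
    (hl : ∀ i, HasLaw (w i) (ρ i) P) (h : ∀ i, IsStandardizedLaw (ρ i) C) (s : Finset ι) :
    Integrable (fun ω => ∑ i ∈ s, (w i ω ^ 2 - 1)) P ∧
    Integrable (fun ω => (∑ i ∈ s, (w i ω ^ 2 - 1)) ^ 2) P ∧
    ∫ ω, |∑ i ∈ s, (w i ω ^ 2 - 1)| ∂P ≤ Real.sqrt (s.card * C) ∧
    ∫ ω, (∑ i ∈ s, (w i ω ^ 2 - 1)) ^ 2 ∂P ≤ s.card * C := by
  have hi' : iIndepFun (fun i ω => w i ω ^ 2 - 1) P :=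
    hi.comp (fun _ x => x ^ 2 - 1) fun _ => by fun_prop
  have hm : ∀ i, Measurable fun ω => w i ω ^ 2 - 1 := fun i => by fun_prop
  have i1 : ∀ i, Integrable (fun ω => w i ω ^ 2) P := fun i =>
    (hl i).integrable_fun_comp
      (integrable_pow_of_four measurable_id (h i).integrable_four 2 (by norm_num))
  have i2 : ∀ i, Integrable (fun ω => (w i ω ^ 2 - 1) ^ 2) P := fun i =>
    (hl i).integrable_fun_comp (integral_pow_two_le (h i)).1
  have e0 : ∀ i, ∫ ω, w i ω ^ 2 - 1 ∂P = 0 := fun i => by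
    rw [integral_sub (i1 i) (integrable_const 1)]
    have := (hl i).integral_comp (f := fun x : ℝ => x ^ 2) (by fun_prop)
    simp only [Function.comp_def] at this
    rw [this, (h i).var]
    simp
  have e2 : ∀ i, ∫ ω, (w i ω ^ 2 - 1) ^ 2 ∂P ≤ C := fun i => by
    have := (hl i).integral_comp (f := fun x : ℝ => (x ^ 2 - 1) ^ 2) (by fun_prop)
    simp only [Function.comp_def] at this
    rw [this]
    linarith [(integral_pow_two_le (h i)).2]
  obtain ⟨j1, j2⟩ := integral_sum_sq_of_iIndepFun hm hi' i2 e0 s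
  refine ⟨integrable_finsetSum _ fun i _ => (i1 i).sub (integrable_const 1), j1,
    integral_abs_sum_le_of_iIndepFun hm hi' i2 e0 e2 s, ?_⟩
  rw [j2]
  exact (Finset.sum_le_sum fun i _ => e2 i).trans (by simp)

/-- Integrates `|q|³ ≤ N³ + q⁴ / N`, split at the natural size `|q| = N`, against the fourth-moment
bound of order `N⁴`. -/
lemma integral_abs_offDiag_cube_le {w : ι → Ω → ℝ} (hw : ∀ i, Measurable (w i))
    (hi : iIndepFun w P) {ρ : ι → Measure ℝ} [∀ i, IsProbabilityMeasure (ρ i)]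
    (hl : ∀ i, HasLaw (w i) (ρ i) P) (h : ∀ i, IsStandardizedLaw (ρ i) C) {s : Finset ι}
    (hs : s.Nonempty) :
    Integrable (fun ω => |offDiag s (fun i => w i ω)| ^ 3) P ∧
    ∫ ω, |offDiag s (fun i => w i ω)| ^ 3 ∂P ≤
      (1 + (100 + 16 * C) * (3 + C)) * (s.card : ℝ) ^ 3 := by
  have h4 : ∀ i, Integrable (fun ω => w i ω ^ 4) P := fun i =>
    (hl i).integrable_fun_comp (h i).integrable_four
  have key : ∀ i (k : ℕ), ∫ ω, w i ω ^ k ∂P = ∫ x, x ^ k ∂(ρ i) := fun i k =>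
    (hl i).integral_comp (f := fun x : ℝ => x ^ k) (by fun_prop)
  have h0 : ∀ i, ∫ ω, w i ω ∂P = 0 := fun i => by
    simpa [(h i).mean] using key i 1
  have hC0 : 0 ≤ C := by
    obtain ⟨i, _⟩ := hs
    linarith [(h i).one_le]
  have hq := integral_offDiag_four_le hw hi h4 h0 (fun i => by rw [key, (h i).var]) hC0
    (fun i => by rw [key]; exact (h i).four_le) s
  have iq := integrable_offDiag_four hw hi h4 s
  have i3 : Integrable (fun ω => |offDiag s (fun i => w i ω)| ^ 3) P := by
    simpa [abs_pow] using (integrable_pow_of_four (measurable_offDiag hw s) iq 3 (by norm_num)).abs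
  refine ⟨i3, ?_⟩
  have hN : (0 : ℝ) < s.card := by exact_mod_cast hs.card_pos
  set N : ℝ := (s.card : ℝ)
  calc _ ≤ ∫ ω, N ^ 3 + 1 / N * offDiag s (fun i => w i ω) ^ 4 ∂P := by
        refine integral_mono i3 ((integrable_const _).fun_add (iq.const_mul _)) fun ω => ?_
        simp only
        generalize offDiag s (fun i => w i ω) = q
        rw [← Even.pow_abs (by decide : Even 4) q]
        have hq0 := abs_nonneg q
        rcases le_total |q| N with hle | hle
        · have h1 : |q| ^ 3 ≤ N ^ 3 := by gcongr
          have h2 : 0 ≤ 1 / N * |q| ^ 4 := by positivity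
          linarith
        · have h1 : |q| ^ 3 ≤ 1 / N * |q| ^ 4 := by
            rw [one_div, ← div_eq_inv_mul, le_div_iff₀ hN]
            calc |q| ^ 3 * N ≤ |q| ^ 3 * |q| := by gcongr
              _ = |q| ^ 4 := by ring
          have h2 : 0 ≤ N ^ 3 := by positivity
          linarith
    _ = N ^ 3 + 1 / N * ∫ ω, offDiag s (fun i => w i ω) ^ 4 ∂P := by
        rw [integral_add (integrable_const _) (iq.const_mul _), integral_const_mul]
        simp
    _ ≤ N ^ 3 + 1 / N * ((100 + 16 * C) * (3 + C) * N ^ 4) := by gcongr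
    _ = _ := by field_simp

/-- With `D = ∑ (w i ^ 2 - 1)` the quantity equals `2D/N + D²/N² - ∑ w i ^ 4 / N²`, and `E D² ≤ N
C`. It measures how far the conditional variance of a row is from its limit. -/
lemma integral_abs_offDiag_sq_sub_one_le {w : ι → Ω → ℝ} (hw : ∀ i, Measurable (w i))
    (hi : iIndepFun w P) {ρ : ι → Measure ℝ} [∀ i, IsProbabilityMeasure (ρ i)]
    (hl : ∀ i, HasLaw (w i) (ρ i) P) (h : ∀ i, IsStandardizedLaw (ρ i) C) {s : Finset ι}
    (hs : s.Nonempty) :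
    Integrable (fun ω => offDiag s (fun i => w i ω ^ 2) / (s.card : ℝ) ^ 2 - 1) P ∧
    ∫ ω, |offDiag s (fun i => w i ω ^ 2) / (s.card : ℝ) ^ 2 - 1| ∂P ≤
      2 * Real.sqrt (s.card * C) / s.card + 2 * C / s.card := by
  obtain ⟨k1, k2, k3, k4⟩ := integral_abs_sum_sq_sub_one_le hw hi hl h s
  have h4 : ∀ i, Integrable (fun ω => w i ω ^ 4) P := fun i =>
    (hl i).integrable_fun_comp (h i).integrable_four
  have key : ∀ i (k : ℕ), ∫ ω, w i ω ^ k ∂P = ∫ x, x ^ k ∂(ρ i) := fun i k =>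
    (hl i).integral_comp (f := fun x : ℝ => x ^ k) (by fun_prop)
  have k5 : Integrable (fun ω => ∑ i ∈ s, w i ω ^ 4) P := integrable_finsetSum _ fun i _ => h4 i
  have k6 : ∫ ω, ∑ i ∈ s, w i ω ^ 4 ∂P ≤ s.card * C := by
    rw [integral_finsetSum _ fun i _ => h4 i]
    refine (Finset.sum_le_sum (g := fun _ => C) fun i _ => ?_).trans (by simp)
    rw [key]; exact (h i).four_le
  have hN : (0 : ℝ) < s.card := by exact_mod_cast hs.card_pos
  have e : ∀ ω, offDiag s (fun i => w i ω ^ 2) / (s.card : ℝ) ^ 2 - 1 =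
      2 / (s.card : ℝ) * ∑ i ∈ s, (w i ω ^ 2 - 1) +
      1 / (s.card : ℝ) ^ 2 * (∑ i ∈ s, (w i ω ^ 2 - 1)) ^ 2 -
      1 / (s.card : ℝ) ^ 2 * ∑ i ∈ s, w i ω ^ 4 := fun ω => by
    simp only [offDiag, Finset.sum_sub_distrib, Finset.sum_const, nsmul_eq_mul, mul_one, ← pow_mul]
    field_simp
    ring
  have I : Integrable (fun ω => offDiag s (fun i => w i ω ^ 2) / (s.card : ℝ) ^ 2 - 1) P := by
    simp only [e]
    exact ((k1.const_mul _).fun_add (k2.const_mul _)).sub (k5.const_mul _)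
  refine ⟨I, ?_⟩
  set N : ℝ := (s.card : ℝ)
  calc _ ≤ ∫ ω, 2 / N * |∑ i ∈ s, (w i ω ^ 2 - 1)| +
        1 / N ^ 2 * (∑ i ∈ s, (w i ω ^ 2 - 1)) ^ 2 + 1 / N ^ 2 * ∑ i ∈ s, w i ω ^ 4 ∂P := by
        refine integral_mono I.abs (((k1.abs.const_mul _).fun_add (k2.const_mul _)).fun_add
          (k5.const_mul _)) fun ω => ?_
        simp only [e]
        refine (abs_sub _ _).trans ?_
        have p4 : 0 ≤ ∑ i ∈ s, w i ω ^ 4 := Finset.sum_nonneg fun i _ => by positivity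
        rw [abs_of_nonneg (show 0 ≤ 1 / N ^ 2 * ∑ i ∈ s, w i ω ^ 4 by positivity)]
        gcongr
        refine (abs_add_le _ _).trans ?_
        rw [abs_of_nonneg (show 0 ≤ 1 / N ^ 2 * (∑ i ∈ s, (w i ω ^ 2 - 1)) ^ 2 by positivity),
          abs_mul, abs_of_pos (show 0 < 2 / N by positivity)]
    _ = 2 / N * ∫ ω, |∑ i ∈ s, (w i ω ^ 2 - 1)| ∂P +
        1 / N ^ 2 * ∫ ω, (∑ i ∈ s, (w i ω ^ 2 - 1)) ^ 2 ∂P +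
        1 / N ^ 2 * ∫ ω, ∑ i ∈ s, w i ω ^ 4 ∂P := by
        rw [integral_add ((k1.abs.const_mul _).fun_add (k2.const_mul _)) (k5.const_mul _),
          integral_add (k1.abs.const_mul _) (k2.const_mul _), integral_const_mul,
          integral_const_mul, integral_const_mul]
    _ ≤ 2 / N * Real.sqrt (N * C) + 1 / N ^ 2 * (N * C) + 1 / N ^ 2 * (N * C) := by gcongr
    _ = _ := by field_simp; ring

end Standardized

lemma hasLaw_eval_pi (j : Fin n) :
    HasLaw (fun x : Fin n → ℝ => x j) μ (Measure.pi fun _ : Fin n => μ) :=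
  (measurePreserving_eval (fun _ : Fin n => μ) j).hasLaw

lemma iIndepFun_eval_pi :
    iIndepFun (fun (j : Fin n) (x : Fin n → ℝ) => x j) (Measure.pi fun _ : Fin n => μ) :=
  iIndepFun_pi (X := fun _ x => x) fun _ => by fun_prop

lemma iIndepFun_mul_prod_pi :
    iIndepFun (fun (j : Fin n) (z : (Fin n → ℝ) × (Fin n → ℝ)) => z.1 j * z.2 j)
      ((Measure.pi fun _ : Fin n => μ).prod (Measure.pi fun _ : Fin n => ν)) := by
  refine iIndepFun_of_comp_measurePreserving
    (measurePreserving_arrowProdEquivProdArrow ℝ ℝ (Fin n) (fun _ => μ) (fun _ => ν))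
    (fun j => by fun_prop) ?_
  exact iIndepFun_pi (μ := fun _ : Fin n => μ.prod ν) (X := fun _ z => z.1 * z.2)
    fun _ => by fun_prop

lemma hasLaw_mul_prod_pi (j : Fin n) :
    HasLaw (fun z : (Fin n → ℝ) × (Fin n → ℝ) => z.1 j * z.2 j)
      ((μ.prod ν).map fun z => z.1 * z.2)
      ((Measure.pi fun _ : Fin n => μ).prod (Measure.pi fun _ : Fin n => ν)) := by
  have h := ((measurePreserving_eval (fun _ : Fin n => μ) j).prod
    (measurePreserving_eval (fun _ : Fin n => ν) j)).map_eq
  refine ⟨by fun_prop, ?_⟩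
  rw [← h, Measure.map_map (by fun_prop) (by fun_prop)]
  rfl

end Product

/-! ### Joint law, conditioning on the vector, and the characteristic function bound -/

section Joint

/-- The joint law of a vector with i.i.d. entries of law `μ` and an independent matrix with i.i.d.
entries of law `ν`. -/
def vectorMatrixLaw (m n : ℕ) (μ ν : Measure ℝ) :
    Measure ((Fin n → ℝ) × (Fin m → Fin n → ℝ)) :=
  (Measure.pi fun _ => μ).prod (Measure.pi fun _ => Measure.pi fun _ => ν)

variable {μ ν : Measure ℝ} [IsProbabilityMeasure μ] [IsProbabilityMeasure ν] {A B : ℝ} {m n : ℕ}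

instance : IsProbabilityMeasure (vectorMatrixLaw m n μ ν) := by
  unfold vectorMatrixLaw; infer_instance

lemma measurePreserving_curry_pi :
    MeasurePreserving (fun (f : Fin m × Fin n → ℝ) k j => f (k, j))
      (Measure.pi fun _ => ν) (Measure.pi fun _ => Measure.pi fun _ => ν) := by
  -- The inverse direction is easier: product measures are determined on boxes, and the pullback of
  -- a box is a box of boxes.
  have h : MeasurePreserving (MeasurableEquiv.curry (Fin m) (Fin n) ℝ).symm
      (Measure.pi fun _ => Measure.pi fun _ => ν) (Measure.pi fun _ => ν) := by
    refine ⟨(MeasurableEquiv.curry (Fin m) (Fin n) ℝ).symm.measurable, (Measure.pi_eq fun s _ => ?_).symm⟩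
    rw [MeasurableEquiv.map_apply]
    have e : (MeasurableEquiv.curry (Fin m) (Fin n) ℝ).symm ⁻¹' (Set.univ.pi s) =
        Set.univ.pi fun k => Set.univ.pi fun j => s (k, j) := by
      ext f
      simp only [Set.mem_preimage, Set.mem_pi, Set.mem_univ, true_imp_iff, Prod.forall]
      rfl
    rw [e]
    simp only [Measure.pi_pi]
    rw [Fintype.prod_prod_type]
  exact h.symm

lemma IsIIDVectorMatrix.hasLaw {Ω : Type*} [MeasurableSpace Ω] {P : Measure Ω}
    {X : Ω → EuclideanSpace ℝ (Fin n)} {S : Ω → Matrix (Fin m) (Fin n) ℝ}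
    (h : IsIIDVectorMatrix P X S μ ν) :
    HasLaw (fun ω => ((fun j => X ω j, fun k j => S ω k j) :
      (Fin n → ℝ) × (Fin m → Fin n → ℝ))) (vectorMatrixLaw m n μ ν) P := by
  have h1 := h.indep.hasLaw_pi (μ := Sum.elim (fun _ => μ) (fun _ => ν)) (by
    rintro (j | p)
    · exact h.law_vector j
    · exact h.law_matrix p.1 p.2)
  have : ∀ e : Fin n ⊕ (Fin m × Fin n),
      IsProbabilityMeasure (Sum.elim (fun _ => μ) (fun _ => ν) e) := by
    rintro (j | p)
    · exact ‹IsProbabilityMeasure μ›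
    · exact ‹IsProbabilityMeasure ν›
  have h2 := measurePreserving_sumPiEquivProdPi (X := fun _ : Fin n ⊕ (Fin m × Fin n) => ℝ)
    (Sum.elim (fun _ => μ) (fun _ => ν))
  have h3 : MeasurePreserving _ _ (vectorMatrixLaw m n μ ν) :=
    ((MeasurePreserving.id (Measure.pi fun _ : Fin n => μ)).prod
      (measurePreserving_curry_pi (ν := ν) (m := m) (n := n))).comp h2
  exact h3.hasLaw.comp h1

lemma measurePreserving_row (k : Fin m) :
    MeasurePreserving (fun z : (Fin n → ℝ) × (Fin m → Fin n → ℝ) => (z.1, z.2 k))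
      (vectorMatrixLaw m n μ ν)
      ((Measure.pi fun _ : Fin n => μ).prod (Measure.pi fun _ : Fin n => ν)) :=
  (MeasurePreserving.id _).prod (measurePreserving_eval (fun _ => Measure.pi fun _ => ν) k)

instance : IsProbabilityMeasure ((μ.prod ν).map fun z => z.1 * z.2) :=
  Measure.isProbabilityMeasure_map (by fun_prop)

/-- Rows share the vector and are not independent, so they are added by the triangle inequality.
This costs `m` instead of `√m`, which `m/n → 0` makes affordable. -/
lemma integral_abs_sum_diag_le (hμ : IsStandardizedLaw μ A) (hν : IsStandardizedLaw ν B) :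
    Integrable (fun z : (Fin n → ℝ) × (Fin m → Fin n → ℝ) =>
      ∑ k, ∑ j, ((z.1 j * z.2 k j) ^ 2 - 1)) (vectorMatrixLaw m n μ ν) ∧
    ∫ z, |∑ k, ∑ j, ((z.1 j * z.2 k j) ^ 2 - 1)| ∂(vectorMatrixLaw m n μ ν) ≤
      m * Real.sqrt (n * (A * B)) := by
  obtain ⟨h1, -, h2, -⟩ := integral_abs_sum_sq_sub_one_le (fun j : Fin n => by fun_prop)
    (iIndepFun_mul_prod_pi (μ := μ) (ν := ν) (n := n)) hasLaw_mul_prod_pi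
    (fun _ => hμ.mul hν) Finset.univ
  have i1 : ∀ k : Fin m, Integrable (fun z : (Fin n → ℝ) × (Fin m → Fin n → ℝ) =>
      ∑ j, ((z.1 j * z.2 k j) ^ 2 - 1)) (vectorMatrixLaw m n μ ν) := fun k =>
    (measurePreserving_row k).hasLaw.integrable_fun_comp h1
  have e1 : ∀ k : Fin m, ∫ z, |∑ j, ((z.1 j * z.2 k j) ^ 2 - 1)| ∂(vectorMatrixLaw m n μ ν) ≤
      Real.sqrt (n * (A * B)) := fun k => by
    have := (measurePreserving_row (μ := μ) (ν := ν) (n := n) k).hasLaw.integral_comp h1.abs.1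
    simp only [Function.comp_def] at this
    rw [this]
    simpa using h2
  refine ⟨integrable_finsetSum _ fun k _ => i1 k, ?_⟩
  calc _ ≤ ∫ z, ∑ k, |∑ j, ((z.1 j * z.2 k j) ^ 2 - 1)| ∂(vectorMatrixLaw m n μ ν) :=
        integral_mono (integrable_finsetSum _ fun k _ => i1 k).abs
          (integrable_finsetSum _ fun k _ => (i1 k).abs) fun z => Finset.abs_sum_le_sum_abs _ _
    _ = ∑ k, ∫ z, |∑ j, ((z.1 j * z.2 k j) ^ 2 - 1)| ∂(vectorMatrixLaw m n μ ν) :=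
        integral_finsetSum _ fun k _ => (i1 k).abs
    _ ≤ ∑ k : Fin m, Real.sqrt (n * (A * B)) := Finset.sum_le_sum fun k _ => e1 k
    _ = _ := by simp

/-- Fubini: for a fixed vector the rows are i.i.d., so the inner integral of the product is a power.
-/
lemma integral_cexp_sum_rows (f : (Fin n → ℝ) → (Fin n → ℝ) → ℂ)
    (hf : Measurable fun z : (Fin n → ℝ) × (Fin n → ℝ) => f z.1 z.2) (hb : ∀ x s, ‖f x s‖ ≤ 1) :
    ∫ z, ∏ k, f z.1 (z.2 k) ∂(vectorMatrixLaw m n μ ν) =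
      ∫ x, (∫ s, f x s ∂(Measure.pi fun _ : Fin n => ν)) ^ m ∂(Measure.pi fun _ : Fin n => μ) := by
  unfold vectorMatrixLaw
  rw [integral_prod]
  · refine integral_congr_ae (ae_of_all _ fun x => ?_)
    simp only
    rw [integral_fintype_prod_eq_pow, Fintype.card_fin]
  · have hm : ∀ k : Fin m, Measurable fun z : (Fin n → ℝ) × (Fin m → Fin n → ℝ) =>
        f z.1 (z.2 k) := fun k =>
      hf.comp (f := fun z : (Fin n → ℝ) × (Fin m → Fin n → ℝ) => (z.1, z.2 k)) (by fun_prop)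
    refine Integrable.of_bound (C := 1)
      (Finset.measurable_prod _ fun k _ => hm k).aestronglyMeasurable (ae_of_all _ fun z => ?_)
    rw [norm_prod]
    exact Finset.prod_le_one (fun _ _ => norm_nonneg _) fun _ _ => hb _ _

/-- The central limit estimate with the vector frozen, with `τ = t²`. The middle term is the price
of the conditional variance not being exactly `2n²`. -/
lemma norm_integral_cexp_offDiag_pow_sub_le (hν : IsStandardizedLaw ν B) (hm : 0 < m) (hn : 0 < n)
    (t : ℝ) (x : Fin n → ℝ) :
    ‖(∫ s, Complex.exp ((t / (Real.sqrt (2 * m) * n) *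
        offDiag Finset.univ (fun j => x j * s j) : ℝ) * Complex.I)
          ∂(Measure.pi fun _ : Fin n => ν)) ^ m - Complex.exp ((-t ^ 2 / 2 : ℝ) : ℂ)‖ ≤
      4 * m * |t / (Real.sqrt (2 * m) * n)| ^ 3 *
        ∫ s, |offDiag Finset.univ (fun j => x j * s j)| ^ 3 ∂(Measure.pi fun _ : Fin n => ν) +
      t ^ 2 / 2 * |offDiag Finset.univ (fun j => x j ^ 2) / (n : ℝ) ^ 2 - 1| + t ^ 4 / (4 * m) := by
  have hm' : (0 : ℝ) < m := by exact_mod_cast hm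
  have hn' : (0 : ℝ) < n := by exact_mod_cast hn
  set M := Real.sqrt (2 * m) with hM
  have hM0 : 0 < M := Real.sqrt_pos.2 (by positivity)
  have hM2 : M ^ 2 = 2 * m := Real.sq_sqrt (by positivity)
  set u := t / (M * n) with hu
  set νn := Measure.pi fun _ : Fin n => ν with hνn
  have w1 : iIndepFun (fun (j : Fin n) (s : Fin n → ℝ) => x j * s j) νn :=
    iIndepFun_eval_pi.comp (fun j y => x j * y) fun j => by fun_prop
  have w2 : ∀ j : Fin n, ∀ k : ℕ, ∫ s : Fin n → ℝ, (x j * s j) ^ k ∂νn = x j ^ k * ∫ y, y ^ k ∂ν :=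
    fun j k => by
      simp only [mul_pow]
      rw [integral_const_mul]
      congr 1
      exact (hasLaw_eval_pi j).integral_comp (f := fun y : ℝ => y ^ k) (by fun_prop)
  have w3 : ∀ j : Fin n, Integrable (fun s : Fin n → ℝ => (x j * s j) ^ 4) νn := fun j => by
    simp only [mul_pow]
    exact ((hasLaw_eval_pi j).integrable_fun_comp hν.integrable_four).const_mul _
  have w4 : ∀ j : Fin n, ∫ s : Fin n → ℝ, x j * s j ∂νn = 0 := fun j => by
    simpa [hν.mean] using w2 j 1
  have hw : ∀ j : Fin n, Measurable fun s : Fin n → ℝ => x j * s j := fun j => by fun_prop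
  have v := integral_offDiag_sq hw w1 w3 w4 Finset.univ
  simp only [w2, hν.var, mul_one] at v
  have main := norm_integral_cexp_pow_sub_exp_le (measurable_offDiag hw Finset.univ)
    (integrable_offDiag_four hw w1 w3 Finset.univ)
    (integral_offDiag hw w1 w3 w4 Finset.univ) u hm (sq_nonneg t)
  refine main.trans (le_of_eq ?_)
  have e2 : |m * u ^ 2 * (∫ s, offDiag Finset.univ (fun j => x j * s j) ^ 2 ∂νn) - t ^ 2| / 2 =
      t ^ 2 / 2 * |offDiag Finset.univ (fun j => x j ^ 2) / (n : ℝ) ^ 2 - 1| := by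
    have : m * u ^ 2 * (∫ s, offDiag Finset.univ (fun j => x j * s j) ^ 2 ∂νn) - t ^ 2 =
        t ^ 2 * (offDiag Finset.univ (fun j => x j ^ 2) / (n : ℝ) ^ 2 - 1) := by
      rw [v, hu, div_pow, mul_pow, hM2]
      field_simp
    rw [this, abs_mul, abs_of_nonneg (sq_nonneg t)]
    ring
  rw [e2]
  ring

lemma norm_integral_cexp_sum_offDiag_sub_le (hμ : IsStandardizedLaw μ A)
    (hν : IsStandardizedLaw ν B) (hm : 0 < m) (hn : 0 < n) (t : ℝ) :
    ‖∫ z, Complex.exp ((t / (Real.sqrt (2 * m) * n) *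
        ∑ k, offDiag Finset.univ (fun j => z.1 j * z.2 k j) : ℝ) * Complex.I)
          ∂(vectorMatrixLaw m n μ ν) - Complex.exp ((-t ^ 2 / 2 : ℝ) : ℂ)‖ ≤
      2 * |t| ^ 3 * (1 + (100 + 16 * (A * B)) * (3 + A * B)) / Real.sqrt (2 * m) +
      t ^ 2 * (Real.sqrt (n * A) / n + A / n) + t ^ 4 / (4 * m) := by
  have hm' : (0 : ℝ) < m := by exact_mod_cast hm
  have hn' : (0 : ℝ) < n := by exact_mod_cast hn
  have hne : (Finset.univ : Finset (Fin n)).Nonempty := ⟨⟨0, hn⟩, Finset.mem_univ _⟩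
  set M := Real.sqrt (2 * m) with hM
  have hM0 : 0 < M := Real.sqrt_pos.2 (by positivity)
  have hM2 : M ^ 2 = 2 * m := Real.sq_sqrt (by positivity)
  set u := t / (M * n) with hu
  set μn := Measure.pi fun _ : Fin n => μ with hμn
  set νn := Measure.pi fun _ : Fin n => ν with hνn
  set q : (Fin n → ℝ) → (Fin n → ℝ) → ℝ := fun x s => offDiag Finset.univ (fun j => x j * s j)
  have hqm : Measurable fun z : (Fin n → ℝ) × (Fin n → ℝ) => q z.1 z.2 :=
    measurable_offDiag (w := fun j (z : (Fin n → ℝ) × (Fin n → ℝ)) => z.1 j * z.2 j)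
      (fun j => by fun_prop) _
  set φ : (Fin n → ℝ) → ℂ := fun x => ∫ s, Complex.exp ((u * q x s : ℝ) * Complex.I) ∂νn with hφ
  have hfm : Measurable fun z : (Fin n → ℝ) × (Fin n → ℝ) =>
      Complex.exp ((u * q z.1 z.2 : ℝ) * Complex.I) := by fun_prop
  have e1 : ∫ z, Complex.exp ((u * ∑ k, q z.1 (z.2 k) : ℝ) * Complex.I) ∂(vectorMatrixLaw m n μ ν) =
      ∫ x, φ x ^ m ∂μn := by
    have pt : ∀ z : (Fin n → ℝ) × (Fin m → Fin n → ℝ),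
        Complex.exp ((u * ∑ k, q z.1 (z.2 k) : ℝ) * Complex.I) =
          ∏ k, Complex.exp ((u * q z.1 (z.2 k) : ℝ) * Complex.I) := fun z => by
      rw [← Complex.exp_sum, Finset.mul_sum]
      push_cast
      rw [Finset.sum_mul]
    simp only [pt]
    exact integral_cexp_sum_rows (fun x s => Complex.exp ((u * q x s : ℝ) * Complex.I)) hfm
      fun x s => (Complex.norm_exp_ofReal_mul_I _).le
  have hφm : Measurable φ :=
    (hfm.stronglyMeasurable.integral_prod_right (ν := νn)).measurable
  have hφ1 : ∀ x, ‖φ x‖ ≤ 1 := fun x => by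
    refine (norm_integral_le_of_norm_le_const (C := 1) (ae_of_all _ fun s => ?_)).trans (by simp)
    exact (Complex.norm_exp_ofReal_mul_I _).le
  have iφ : Integrable (fun x => φ x ^ m) μn := by
    refine Integrable.of_bound (C := 1) (hφm.pow_const m).aestronglyMeasurable (ae_of_all _ fun x => ?_)
    rw [norm_pow]
    exact pow_le_one₀ (norm_nonneg _) (hφ1 x)
  obtain ⟨c1, c2⟩ := integral_abs_offDiag_cube_le (fun j : Fin n => by fun_prop)
    (iIndepFun_mul_prod_pi (μ := μ) (ν := ν) (n := n)) hasLaw_mul_prod_pi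
    (fun _ => hμ.mul hν) hne
  obtain ⟨d1, d2⟩ := integral_abs_offDiag_sq_sub_one_le (fun j : Fin n => by fun_prop)
    (iIndepFun_eval_pi (μ := μ) (n := n)) hasLaw_eval_pi (fun _ => hμ) hne
  simp only [Finset.card_univ, Fintype.card_fin] at c2 d1 d2
  have c2' : ∫ x, ∫ s, |q x s| ^ 3 ∂νn ∂μn ≤
      (1 + (100 + 16 * (A * B)) * (3 + A * B)) * (n : ℝ) ^ 3 := by
    rw [integral_prod _ c1] at c2
    exact c2
  have c1' : Integrable (fun x => ∫ s, |q x s| ^ 3 ∂νn) μn := c1.integral_prod_left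
  have ptw : ∀ x, ‖φ x ^ m - Complex.exp ((-t ^ 2 / 2 : ℝ) : ℂ)‖ ≤
      4 * m * |u| ^ 3 * ∫ s, |q x s| ^ 3 ∂νn +
      t ^ 2 / 2 * |offDiag Finset.univ (fun j => x j ^ 2) / (n : ℝ) ^ 2 - 1| + t ^ 4 / (4 * m) := fun x =>
    norm_integral_cexp_offDiag_pow_sub_le hν hm hn t x
  have key : ∫ x, φ x ^ m ∂μn - Complex.exp ((-t ^ 2 / 2 : ℝ) : ℂ) =
      ∫ x, (φ x ^ m - Complex.exp ((-t ^ 2 / 2 : ℝ) : ℂ)) ∂μn := by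
    rw [integral_sub iφ (integrable_const _)]
    simp
  change ‖∫ z, Complex.exp ((u * ∑ k, q z.1 (z.2 k) : ℝ) * Complex.I) ∂(vectorMatrixLaw m n μ ν) -
    _‖ ≤ _
  rw [e1, key]
  have g1 := (c1'.const_mul (4 * m * |u| ^ 3))
  have g2 := (d1.abs.const_mul (t ^ 2 / 2))
  have g3 : Integrable (fun x => 4 * m * |u| ^ 3 * ∫ s, |q x s| ^ 3 ∂νn +
      t ^ 2 / 2 * |offDiag Finset.univ (fun j => x j ^ 2) / (n : ℝ) ^ 2 - 1| + t ^ 4 / (4 * m)) μn :=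
    (g1.fun_add g2).fun_add (integrable_const (t ^ 4 / (4 * m)))
  have g4 := norm_integral_le_of_norm_le g3 (ae_of_all _ ptw)
  refine g4.trans ?_
  rw [integral_add (g1.fun_add g2) (integrable_const _), integral_add g1 g2, integral_const_mul,
    integral_const_mul]
  simp only [integral_const, probReal_univ, one_smul]
  -- The powers of `n` cancel and `m` rows against `(2m)^{-3/2}` leave the Lyapunov rate `m^{-1/2}`.
  have hu3 : 4 * m * |u| ^ 3 * (n : ℝ) ^ 3 = 2 * |t| ^ 3 / M := by
    rw [hu, abs_div, abs_of_pos (show 0 < M * n by positivity), div_pow, mul_pow]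
    have : (m : ℝ) = M ^ 2 / 2 := by rw [hM2]; ring
    rw [this]
    field_simp
    ring
  gcongr ?_ + ?_ + _
  · calc _ ≤ 4 * m * |u| ^ 3 * ((1 + (100 + 16 * (A * B)) * (3 + A * B)) * (n : ℝ) ^ 3) := by gcongr
      _ = (4 * m * |u| ^ 3 * (n : ℝ) ^ 3) * (1 + (100 + 16 * (A * B)) * (3 + A * B)) := by ring
      _ = _ := by rw [hu3]; ring
  · calc _ ≤ t ^ 2 / 2 * (2 * Real.sqrt (n * A) / n + 2 * A / n) := by gcongr
      _ = _ := by ring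

lemma norm_toLp_mulVec_sq_sub (S : Matrix (Fin m) (Fin n) ℝ) (X : EuclideanSpace ℝ (Fin n)) :
    ‖(WithLp.toLp 2 (S.mulVec X.ofLp) : EuclideanSpace ℝ (Fin m))‖ ^ 2 - (m : ℝ) * n =
      ∑ k, offDiag Finset.univ (fun j => X j * S k j) +
        ∑ k, ∑ j, ((X j * S k j) ^ 2 - 1) := by
  rw [EuclideanSpace.norm_sq_eq]
  simp only [offDiag, Finset.sum_sub_distrib, Real.norm_eq_abs, sq_abs, Matrix.mulVec, dotProduct,
    mul_comm]
  simp

/-- The diagonal part is a perturbation of the phase: since `|e^{ia} - 1| ≤ |a|`, dropping it costs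
at most its scaled `L¹` norm, and the off-diagonal estimate applies to the rest. -/
lemma norm_charFun_scaled_sub_le {Ω : Type*} [MeasurableSpace Ω] {P : Measure Ω}
    {X : Ω → EuclideanSpace ℝ (Fin n)} {S : Ω → Matrix (Fin m) (Fin n) ℝ}
    (h : IsIIDVectorMatrix P X S μ ν) (hμ : IsStandardizedLaw μ A)
    (hν : IsStandardizedLaw ν B) (hm : 0 < m) (hn : 0 < n) (t : ℝ) :
    ‖∫ ω, Complex.exp ((t * ((‖(WithLp.toLp 2 ((S ω).mulVec (X ω).ofLp) :
        EuclideanSpace ℝ (Fin m))‖ ^ 2 - (m : ℝ) * n) / (Real.sqrt (2 * m) * n)) : ℝ) * Complex.I) ∂P -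
      Complex.exp ((-t ^ 2 / 2 : ℝ) : ℂ)‖ ≤
      |t| * (Real.sqrt (A * B) * Real.sqrt (m / n)) +
      (2 * |t| ^ 3 * (1 + (100 + 16 * (A * B)) * (3 + A * B)) / Real.sqrt (2 * m) +
      t ^ 2 * (Real.sqrt (n * A) / n + A / n) + t ^ 4 / (4 * m)) := by
  have hm' : (0 : ℝ) < m := by exact_mod_cast hm
  have hn' : (0 : ℝ) < n := by exact_mod_cast hn
  set κ := Real.sqrt (2 * m) * n with hκ
  have hκ0 : 0 < κ := by positivity
  let T : (Fin n → ℝ) × (Fin m → Fin n → ℝ) → ℝ := fun z =>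
    ∑ k, offDiag Finset.univ (fun j => z.1 j * z.2 k j)
  let R : (Fin n → ℝ) × (Fin m → Fin n → ℝ) → ℝ := fun z =>
    ∑ k, ∑ j, ((z.1 j * z.2 k j) ^ 2 - 1)
  have hT : Measurable T :=
    Finset.measurable_sum _ fun k _ => measurable_offDiag (fun j => by fun_prop) _
  have hR : Measurable R := by fun_prop
  have e : ∫ ω, Complex.exp ((t * ((‖(WithLp.toLp 2 ((S ω).mulVec (X ω).ofLp) :
        EuclideanSpace ℝ (Fin m))‖ ^ 2 - (m : ℝ) * n) / κ) : ℝ) * Complex.I) ∂P =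
      ∫ z, Complex.exp ((t * ((T z + R z) / κ) : ℝ) * Complex.I) ∂(vectorMatrixLaw m n μ ν) := by
    rw [← h.hasLaw.integral_comp (Measurable.aestronglyMeasurable (by fun_prop))]
    simp only [norm_toLp_mulVec_sq_sub]
    rfl
  rw [e]
  have i1 : Integrable (fun z => Complex.exp ((t * ((T z + R z) / κ) : ℝ) * Complex.I))
      (vectorMatrixLaw m n μ ν) :=
    Integrable.of_bound (C := 1) (Measurable.aestronglyMeasurable (by fun_prop))
      (ae_of_all _ fun z => (Complex.norm_exp_ofReal_mul_I _).le)
  have i2 : Integrable (fun z => Complex.exp ((t / κ * T z : ℝ) * Complex.I))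
      (vectorMatrixLaw m n μ ν) :=
    Integrable.of_bound (C := 1) (Measurable.aestronglyMeasurable (by fun_prop))
      (ae_of_all _ fun z => (Complex.norm_exp_ofReal_mul_I _).le)
  obtain ⟨r1, r2⟩ := integral_abs_sum_diag_le (m := m) (n := n) hμ hν
  refine (norm_sub_le_norm_sub_add_norm_sub _
    (∫ z, Complex.exp ((t / κ * T z : ℝ) * Complex.I) ∂(vectorMatrixLaw m n μ ν)) _).trans ?_
  refine add_le_add ?_ (norm_integral_cexp_sum_offDiag_sub_le hμ hν hm hn t)
  rw [← integral_sub i1 i2]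
  refine (norm_integral_le_of_norm_le (r1.abs.const_mul (|t| / κ))
    (ae_of_all _ fun z => ?_)).trans ?_
  · have e3 : Complex.exp ((t * ((T z + R z) / κ) : ℝ) * Complex.I) -
        Complex.exp ((t / κ * T z : ℝ) * Complex.I) =
        Complex.exp ((t / κ * T z : ℝ) * Complex.I) *
          (Complex.exp (Complex.I * (t / κ * R z : ℝ)) - 1) := by
      rw [mul_sub, mul_one, ← Complex.exp_add]
      congr 2
      push_cast; ring
    rw [e3, norm_mul, Complex.norm_exp_ofReal_mul_I, one_mul]
    refine Real.norm_exp_I_mul_ofReal_sub_one_le.trans (le_of_eq ?_)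
    rw [Real.norm_eq_abs, abs_mul, abs_div, abs_of_pos hκ0]
  · rw [integral_const_mul]
    calc _ ≤ |t| / κ * (m * Real.sqrt (n * (A * B))) := by gcongr
      _ = |t| * (Real.sqrt (A * B) * ((m * Real.sqrt n) / κ)) := by
          rw [Real.sqrt_mul hn'.le]; ring
      _ ≤ _ := by
          gcongr
          rw [hκ, Real.sqrt_mul (by norm_num), Real.sqrt_div hm'.le,
            div_le_div_iff₀ (by positivity) (by positivity)]
          have s1 : Real.sqrt m * Real.sqrt m = m := Real.mul_self_sqrt hm'.le
          have s2 : Real.sqrt n * Real.sqrt n = n := Real.mul_self_sqrt hn'.le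
          have s3 : 1 ≤ Real.sqrt 2 := Real.one_le_sqrt.2 (by norm_num)
          calc (m : ℝ) * Real.sqrt n * Real.sqrt n = 1 * (m * n) := by rw [mul_assoc, s2]; ring
            _ ≤ Real.sqrt 2 * (m * n) := by gcongr
            _ = Real.sqrt m * (Real.sqrt 2 * Real.sqrt m * n) := by
              nth_rewrite 1 [← s1]; ring

end Joint

/-! ### Passage to the limit -/

section Limit

lemma tendsto_probabilityMeasure_of_tendsto_charFun {ι : Type*} {l : Filter ι}
    [l.IsCountablyGenerated] {ρ : ι → ProbabilityMeasure ℝ} {ρ₀ : ProbabilityMeasure ℝ}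
    (h : ∀ t : ℝ, Tendsto (fun i => charFun (ρ i : Measure ℝ) t) l
      (𝓝 (charFun (ρ₀ : Measure ℝ) t))) : Tendsto ρ l (𝓝 ρ₀) :=
  tendsto_of_seq_tendsto fun _ hu =>
    ProbabilityMeasure.tendsto_of_tendsto_charFun fun t => (h t).comp hu

lemma IsStandardizedLaw.one_le_integral_four {ν : Measure ℝ} [IsProbabilityMeasure ν] {C : ℝ}
    (h : IsStandardizedLaw ν C) : 1 ≤ ∫ s, s ^ 4 ∂ν :=
  IsStandardizedLaw.one_le ⟨h.integrable_four, h.mean, h.var, le_rfl⟩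

variable {ι : Type*} {l : Filter ι} {m n : ι → ℕ}

/-- Dividing the radicand by `2mn²` leaves `1 + (σ²/2)(m/n) + ξ/(2n)`, which tends to `1` because
`ξ` is bounded. -/
lemma tendsto_scaling_ratio (hm : Tendsto m l atTop) (hn : Tendsto n l atTop)
    (hmn : Tendsto (fun i => (m i : ℝ) / (n i : ℝ)) l (𝓝 0)) {σ K : ℝ} {ξ : ι → ℝ}
    (hξ : ∀ i, |ξ i| ≤ K) :
    Tendsto (fun i => Real.sqrt (2 * m i) * n i /
      Real.sqrt (σ ^ 2 * (m i : ℝ) ^ 2 * n i + 2 * (m i : ℝ) * (n i : ℝ) ^ 2 + ξ i * m i * n i))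
      l (𝓝 1) := by
  have hn' : Tendsto (fun i => (n i : ℝ)) l atTop := tendsto_natCast_atTop_atTop.comp hn
  have h1 : Tendsto (fun i => ξ i / (2 * n i)) l (𝓝 0) := by
    refine squeeze_zero_norm (a := fun i => K / 2 * (n i : ℝ)⁻¹) (fun i => ?_) ?_
    · rw [Real.norm_eq_abs, abs_div, abs_of_nonneg (show (0 : ℝ) ≤ 2 * n i by positivity)]
      calc |ξ i| / (2 * n i) ≤ K / (2 * n i) := by gcongr; exact hξ i
        _ = _ := by rw [div_mul_eq_div_div, div_eq_mul_inv]
    · simpa using (tendsto_inv_atTop_zero.comp hn').const_mul (K / 2)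
  have h2 : Tendsto (fun i => σ ^ 2 / 2 * ((m i : ℝ) / n i) + 1 + ξ i / (2 * n i)) l (𝓝 1) := by
    simpa using ((hmn.const_mul (σ ^ 2 / 2)).add_const 1).add h1
  have h3 : Tendsto (fun i => (Real.sqrt
      (σ ^ 2 / 2 * ((m i : ℝ) / n i) + 1 + ξ i / (2 * n i)))⁻¹) l (𝓝 1) := by
    simpa using h2.sqrt.inv₀ (by simp)
  refine h3.congr' ?_
  filter_upwards [hm.eventually_gt_atTop 0, hn.eventually_gt_atTop 0] with i hmi hni
  have hmi' : (0 : ℝ) < m i := by exact_mod_cast hmi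
  have hni' : (0 : ℝ) < n i := by exact_mod_cast hni
  have e1 : σ ^ 2 * (m i : ℝ) ^ 2 * n i + 2 * (m i : ℝ) * (n i : ℝ) ^ 2 + ξ i * m i * n i =
      (2 * m i * (n i : ℝ) ^ 2) *
        (σ ^ 2 / 2 * ((m i : ℝ) / n i) + 1 + ξ i / (2 * n i)) := by
    field_simp
  have e2 : Real.sqrt (2 * m i * (n i : ℝ) ^ 2) = Real.sqrt (2 * m i) * n i := by
    rw [Real.sqrt_mul (by positivity), Real.sqrt_sq hni'.le]
  have : 0 < Real.sqrt (2 * m i) * n i := by positivity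
  rw [e1, Real.sqrt_mul (show 0 ≤ 2 * (m i : ℝ) * (n i : ℝ) ^ 2 by positivity), e2, div_mul_cancel_left₀ this.ne']

lemma tendsto_charFun_bound (hm : Tendsto m l atTop) (hn : Tendsto n l atTop)
    (hmn : Tendsto (fun i => (m i : ℝ) / (n i : ℝ)) l (𝓝 0)) {t : ℝ} {u : ι → ℝ}
    (hu : Tendsto u l (𝓝 t)) (A B K : ℝ) :
    Tendsto (fun i => |u i| * (B * Real.sqrt (m i / n i)) +
      (2 * |u i| ^ 3 * K / Real.sqrt (2 * m i) +
      u i ^ 2 * (Real.sqrt (n i * A) / n i + A / n i) + u i ^ 4 / (4 * m i))) l (𝓝 0) := by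
  have hn' : Tendsto (fun i => (n i : ℝ)) l atTop := tendsto_natCast_atTop_atTop.comp hn
  have hm' : Tendsto (fun i => (m i : ℝ)) l atTop := tendsto_natCast_atTop_atTop.comp hm
  have a1 : Tendsto (fun i => Real.sqrt ((m i : ℝ) / n i)) l (𝓝 0) := by simpa using hmn.sqrt
  have a2 : Tendsto (fun i => Real.sqrt (2 * m i)) l atTop :=
    Real.tendsto_sqrt_atTop.comp (hm'.const_mul_atTop (by norm_num))
  have a3 : Tendsto (fun i => A / (n i : ℝ)) l (𝓝 0) := hn'.const_div_atTop A
  have a4 : Tendsto (fun i => Real.sqrt (n i * A) / n i) l (𝓝 0) := by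
    have : Tendsto (fun i => Real.sqrt A / Real.sqrt (n i : ℝ)) l (𝓝 0) :=
      (Real.tendsto_sqrt_atTop.comp hn').const_div_atTop _
    refine this.congr fun i => ?_
    rw [Real.sqrt_mul (Nat.cast_nonneg _), mul_div_right_comm, Real.sqrt_div_self]
    ring
  have a5 : Tendsto (fun i => 4 * (m i : ℝ)) l atTop := hm'.const_mul_atTop (by norm_num)
  have b1 := hu.abs.mul (a1.const_mul B)
  have b2 := (((hu.abs.pow 3).const_mul 2).mul_const K).div_atTop a2
  have b3 := (hu.pow 2).mul (a4.add a3)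
  have b4 := (hu.pow 4).div_atTop a5
  simpa using b1.add ((b2.add b3).add b4)

end Limit

/-! ### The central limit theorem -/

theorem mainTheorem2
    {ι : Type*} (l : Filter ι) (m n : ι → ℕ)
    (hm : Tendsto m l atTop) (hn : Tendsto n l atTop)
    (hmn : Tendsto (fun i => (m i : ℝ) / (n i : ℝ)) l (𝓝 0))
    {Ω : ι → Type*} [∀ i, MeasurableSpace (Ω i)]
    (P : (i : ι) → Measure (Ω i)) [∀ i, IsProbabilityMeasure (P i)]
    (X : (i : ι) → Ω i → EuclideanSpace ℝ (Fin (n i)))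
    (S : (i : ι) → Ω i → Matrix (Fin (m i)) (Fin (n i)) ℝ)
    (μ ν : ι → Measure ℝ)
    [∀ i, IsProbabilityMeasure (μ i)] [∀ i, IsProbabilityMeasure (ν i)]
    (hiid : ∀ i, IsIIDVectorMatrix (P i) (X i) (S i) (μ i) (ν i))
    (σ : ℝ) (hσ : 0 ≤ σ)
    (hX4 : ∀ i, Integrable (fun x : ℝ => x ^ 4) (μ i))
    (hXmean : ∀ i, ∫ x, x ∂(μ i) = 0)
    (hXvar : ∀ i, ∫ x, x ^ 2 ∂(μ i) = 1)
    (hXfour : ∀ i, ∫ x, x ^ 4 ∂(μ i) = 1 + σ ^ 2)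
    (c : ℝ)
    (hS4 : ∀ i, Integrable (fun s : ℝ => s ^ 4) (ν i))
    (hSmean : ∀ i, ∫ s, s ∂(ν i) = 0)
    (hSvar : ∀ i, ∫ s, s ^ 2 ∂(ν i) = 1)
    (hSfour : ∀ i, ∫ s, s ^ 4 ∂(ν i) < c) :
    TendstoInDistribution
      (fun i ω => scaledProjNorm σ (projXi (μ i) (ν i)) (S i ω) (X i ω))
      l (id : ℝ → ℝ) P (gaussianReal 0 1) := by
  have hμ : ∀ i, IsStandardizedLaw (μ i) (1 + σ ^ 2) := fun i =>
    ⟨hX4 i, hXmean i, hXvar i, (hXfour i).le⟩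
  have hν : ∀ i, IsStandardizedLaw (ν i) c := fun i =>
    ⟨hS4 i, hSmean i, hSvar i, (hSfour i).le⟩
  have haem : ∀ i, AEMeasurable
      (fun ω => scaledProjNorm σ (projXi (μ i) (ν i)) (S i ω) (X i ω)) (P i) := fun i => by
    have h1 := fun j => ((hiid i).law_vector j).aemeasurable
    have h2 := fun k j => ((hiid i).law_matrix k j).aemeasurable
    simp only [scaledProjNorm, EuclideanSpace.norm_sq_eq, Matrix.mulVec, dotProduct]
    fun_prop
  refine ⟨haem, aemeasurable_id, ?_⟩
  -- The continuity theorem is applied along a countably generated filter, while `l` is arbitrary.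
  -- `L` is the coarsest filter with the three required limits, and it is countably generated.
  set L : Filter ι := comap m atTop ⊓ comap n atTop ⊓
    comap (fun i => (m i : ℝ) / (n i : ℝ)) (𝓝 0) with hL
  have hlL : l ≤ L := le_inf (le_inf hm.le_comap hn.le_comap) hmn.le_comap
  refine Tendsto.mono_left ?_ hlL
  have hm' : Tendsto m L atTop := tendsto_comap.mono_left (inf_le_left.trans inf_le_left)
  have hn' : Tendsto n L atTop := tendsto_comap.mono_left (inf_le_left.trans inf_le_right)
  have hmn' : Tendsto (fun i => (m i : ℝ) / (n i : ℝ)) L (𝓝 0) :=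
    tendsto_comap.mono_left inf_le_right
  refine tendsto_probabilityMeasure_of_tendsto_charFun fun t => ?_
  -- Follows from `1 ≤ E S₁₁⁴ < c`, the lower bound coming from unit variance.
  have hξ : ∀ i, |projXi (μ i) (ν i)| ≤ c * (1 + σ ^ 2) + 2 := fun i => by
    have h1 := (hν i).one_le_integral_four
    have h2 := hSfour i
    rw [projXi, hXfour, abs_le]
    constructor <;> nlinarith [sq_nonneg σ]
  have hr := tendsto_scaling_ratio (σ := σ) hm' hn' hmn' hξ
  set r : ι → ℝ := fun i => Real.sqrt (2 * m i) * n i /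
    Real.sqrt (σ ^ 2 * (m i : ℝ) ^ 2 * n i + 2 * (m i : ℝ) * (n i : ℝ) ^ 2 +
      projXi (μ i) (ν i) * m i * n i) with hrdef
  -- The change of normalisation is moved into the frequency: the characteristic function at `t` is
  -- the one normalised by `√(2m) n` at `t * r i`, and the explicit error bound still vanishes along
  -- converging frequencies.
  have hu : Tendsto (fun i => t * r i) L (𝓝 t) := by simpa using hr.const_mul t
  have hbound := tendsto_charFun_bound hm' hn' hmn' hu (1 + σ ^ 2)
    (Real.sqrt ((1 + σ ^ 2) * c)) (1 + (100 + 16 * ((1 + σ ^ 2) * c)) * (3 + (1 + σ ^ 2) * c))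
  have hexp : Tendsto (fun i => Complex.exp ((-(t * r i) ^ 2 / 2 : ℝ) : ℂ)) L
      (𝓝 (Complex.exp ((-t ^ 2 / 2 : ℝ) : ℂ))) :=
    (Complex.continuous_exp.comp Complex.continuous_ofReal).tendsto _ |>.comp
      ((hu.pow 2).neg.div_const 2)
  have hlim : charFun ((gaussianReal 0 1).map id) t = Complex.exp ((-t ^ 2 / 2 : ℝ) : ℂ) := by
    rw [Measure.map_id, charFun_gaussianReal]
    congr 1
    push_cast
    simp [neg_div]
  simp only [ProbabilityMeasure.coe_mk, hlim]
  refine tendsto_of_tendsto_of_dist hexp ?_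
  refine squeeze_zero' (Eventually.of_forall fun _ => dist_nonneg) ?_ hbound
  filter_upwards [hm'.eventually_gt_atTop 0, hn'.eventually_gt_atTop 0] with i hmi hni
  have main := norm_charFun_scaled_sub_le (hiid i) (hμ i) (hν i) hmi hni (t * r i)
  rw [dist_comm, dist_eq_norm]
  refine le_of_eq_of_le ?_ main
  congr 2
  rw [charFun_apply_real, integral_map (haem i) (by fun_prop)]
  refine integral_congr_ae (ae_of_all _ fun ω => ?_)
  have hmi' : (0 : ℝ) < m i := by exact_mod_cast hmi
  have hni' : (0 : ℝ) < n i := by exact_mod_cast hni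
  have hκ : Real.sqrt (2 * m i) * n i ≠ 0 := by positivity
  simp only [scaledProjNorm, hrdef]
  rw [← Complex.ofReal_mul]
  congr 3
  generalize ‖(WithLp.toLp 2 ((S i ω).mulVec (X i ω).ofLp) : EuclideanSpace ℝ (Fin (m i)))‖ ^ 2 -
    (m i : ℝ) * n i = N
  generalize Real.sqrt (2 * m i) * n i = κ at *
  rw [mul_assoc t, div_mul_div_comm, mul_comm κ N, mul_div_mul_right _ _ hκ]

end
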